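/- Let $d,n\ge 1$ and let $V:\mathbb Z^d\to\mathbb R^{n\times n}$ satisfy: (E1) $|V_{kl}(z)|\le Ce^{-\alpha|z|}$ for some $C,\alpha>0$; (E2) $V_{lk}(-z)=V_{kl}(z)$; (E3) $\hat V(\theta)=\sum_{z}V(z)e^{iz\cdot\theta}$ is non-negative definite for every $\theta\in\mathbb T^d=\mathbb R^d/2\pi\mathbb Z^d$. Put $\Omega(\theta)=\hat V(\theta)^{1/2}\ge 0$. Define the critical set $\mathcal C\subset\mathbb T^d$ as follows. Let $\mathcal C_*$ be the set of points having no neighbourhood on which $\Omega=B\,\mathrm{diag}(\omega_1,\dots,\omega_n)B^*$ with real-analytic unitary $B(\theta)$ and real-analytic real functions $\omega_k(\theta)$ such that any two of the $\omega_k$ either coincide throughout this neighbourhood or differ at each of its points (constant multiplicities). Let $\mathcal C_0=\{\theta:\det\hat V(\theta)=0\}$. Then $\mathcal C$ is the union of $\mathcal C_*$, $\mathcal C_0$ and the set of all $\theta\notin\mathcal C_*$ at which $\det\big(\partial^2\omega_k/\partial\theta_i\partial\theta_j\big)_{i,j=1}^d=0$ for one of these local functions $\omega_k$. For $\Psi=(\Psi^0,\Psi^1)$,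 a pair of finitely supported functions $\mathbb Z^d\to\mathbb R^n$, let $\hat\Psi(\theta)=\sum_z\Psi(z)e^{iz\cdot\theta}\in\mathbb C^{2n}$, and for $g\in C_0^\infty(\mathbb T^d\setminus\mathcal C)$ (complex-valued) define the truncated dual solution $$\Phi_g(x,t)=(2\pi)^{-d}\int_{\mathbb T^d}e^{-i\theta\cdot x}\,e^{t\hat{\mathcal A}^*(\theta)}\,g(\theta)\hat\Psi(\theta)\,d\theta,\qquad \hat{\mathcal A}^*(\theta)=\begin{pmatrix}0&-\hat V(\theta)\\ 1&0\end{pmatrix},\qquad x\in\mathbb Z^d,\ t\in\mathbb R.$$ Let $|\cdot|$ denote Euclidean norms. Then for every such $g$: i) For every $\Psi$ there is a constant $C>0$ such that $\sup_{x\in\mathbb Z^d}|\Phi_g(x,t)|\le C\,|t|^{-d/2}$ for all real $t\ne 0$. ii) There is $\gamma_g>0$, depending only on $V$ and $g$, such that for every $\Psi$ and every real $p>0$ there is $C_p>0$ with $|\Phi_g(x,t)|\le C_p(|t|+|x|+1)^{-p}$ for all $t\in\mathbb R$ and $x\in\mathbb Z^d$ with $|x|\ge\gamma_g|t|$. -/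

import Mathlib

open MeasureTheory
open scoped Matrix ContDiff ComplexOrder MatrixOrder

noncomputable section

namespace HarmonicCrystal

variable {d n : ℕ}

/-- The Euclidean length of a lattice vector `x ∈ ℤ^d`. -/
def latticeNorm (x : Fin d → ℤ) : ℝ := ‖WithLp.toLp 2 (fun i => (x i : ℝ))‖

/-- The pairing `θ · x` of `θ ∈ ℝ^d` and `x ∈ ℤ^d`. -/
def pairing (θ : Fin d → ℝ) (x : Fin d → ℤ) : ℝ := ∑ i, θ i * (x i : ℝ)

/-- The character `exp (i z · θ)`, a function on the torus `ℝ^d / 2πℤ^d`. -/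
def character (z : Fin d → ℤ) (θ : Fin d → ℝ) : ℂ :=
  Complex.exp (Complex.I * (pairing θ z : ℂ))

/-- Exponential decay of the interaction matrix. -/
def ExponentialDecay (V : (Fin d → ℤ) → Matrix (Fin n) (Fin n) ℝ) : Prop :=
  ∃ C > 0, ∃ α > 0, ∀ (z : Fin d → ℤ) (k l : Fin n),
    |V z k l| ≤ C * Real.exp (-α * latticeNorm z)

/-- Symmetry of the (real) interaction matrix: `V_{lk}(-z) = V_{kl}(z)`. -/
def SymmetricInteraction (V : (Fin d → ℤ) → Matrix (Fin n) (Fin n) ℝ) : Prop :=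
  ∀ (z : Fin d → ℤ) (k l : Fin n), V (-z) l k = V z k l

/-- The Fourier transform `V̂_{kl}(θ) = ∑_z V_{kl}(z) exp (i z · θ)`. -/
def Vhat (V : (Fin d → ℤ) → Matrix (Fin n) (Fin n) ℝ) (θ : Fin d → ℝ) :
    Matrix (Fin n) (Fin n) ℂ :=
  Matrix.of fun k l => ∑' z : Fin d → ℤ, (V z k l : ℂ) * character z θ

/-- The matrix `V̂(θ)` is non-negative definite for every `θ`. -/
def NonnegativeInteraction (V : (Fin d → ℤ) → Matrix (Fin n) (Fin n) ℝ) : Prop :=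
  ∀ θ : Fin d → ℝ, (Vhat V θ).PosSemidef

/-- `Ω(θ) = V̂(θ)^{1/2}`, the non-negative definite square root. -/
def Omega (V : (Fin d → ℤ) → Matrix (Fin n) (Fin n) ℝ) (θ : Fin d → ℝ) :
    Matrix (Fin n) (Fin n) ℂ :=
  CFC.sqrt (Vhat V θ)

/-- On the set `U`, the functions `w_1, …, w_n` and the unitary matrix `B` form a real-analytic
diagonalization of `Ω`, with eigenvalues of constant multiplicity: two of the branches `w_k`,
`w_l` either coincide on `U` or are different at every point of `U`. -/
structure IsAnalyticDiagonalization (V : (Fin d → ℤ) → Matrix (Fin n) (Fin n) ℝ)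
    (U : Set (Fin d → ℝ)) (w : Fin n → (Fin d → ℝ) → ℝ)
    (B : (Fin d → ℝ) → Matrix (Fin n) (Fin n) ℂ) : Prop where
  analytic_eigenvalue : ∀ k, AnalyticOnNhd ℝ (w k) U
  analytic_basis : ∀ k l, AnalyticOnNhd ℝ (fun θ => B θ k l) U
  unitary : ∀ θ ∈ U, B θ ∈ Matrix.unitaryGroup (Fin n) ℂ
  diagonalizes : ∀ θ ∈ U,
    Omega V θ = B θ * Matrix.diagonal (fun k => (w k θ : ℂ)) * (B θ)ᴴ
  constant_multiplicity : ∀ k l,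
    (∀ θ ∈ U, w k θ = w l θ) ∨ (∀ θ ∈ U, w k θ ≠ w l θ)

/-- The determinant of the matrix of second partial derivatives of `f` at `θ`. -/
def hessianDet (f : (Fin d → ℝ) → ℝ) (θ : Fin d → ℝ) : ℝ :=
  Matrix.det (Matrix.of fun i j : Fin d =>
    iteratedFDeriv ℝ 2 f θ ![Pi.single i 1, Pi.single j 1])

/-- The set `C_*` (lifted to `ℝ^d`) of all points that have no neighbourhood with a real-analytic
diagonalization of `Ω`. This is the smallest closed set outside of which the dispersion relations
and the matrix `B` can locally be chosen real-analytic, with constant multiplicities. -/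
def crossingSet (V : (Fin d → ℤ) → Matrix (Fin n) (Fin n) ℝ) : Set (Fin d → ℝ) :=
  {θ | ¬ ∃ U : Set (Fin d → ℝ), IsOpen U ∧ θ ∈ U ∧
    ∃ w B, IsAnalyticDiagonalization V U w B}

/-- The set `C_0` (lifted to `ℝ^d`): the zeros of `det V̂`. -/
def zeroSet (V : (Fin d → ℤ) → Matrix (Fin n) (Fin n) ℝ) : Set (Fin d → ℝ) :=
  {θ | (Vhat V θ).det = 0}

/-- The union `C_1 ∪ … ∪ C_n` (lifted to `ℝ^d`): the points outside `C_*` at which one of the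
local real-analytic dispersion relations has a degenerate Hessian. (Near a point outside `C_*`
these local functions are unique up to their enumeration.) -/
def degenerateSet (V : (Fin d → ℤ) → Matrix (Fin n) (Fin n) ℝ) : Set (Fin d → ℝ) :=
  {θ | θ ∉ crossingSet V ∧ ∃ U : Set (Fin d → ℝ), IsOpen U ∧ θ ∈ U ∧
    ∃ w B, IsAnalyticDiagonalization V U w B ∧ ∃ k, hessianDet (w k) θ = 0}

/-- The critical set `C`, lifted to `ℝ^d`. -/
def criticalSet (V : (Fin d → ℤ) → Matrix (Fin n) (Fin n) ℝ) : Set (Fin d → ℝ) :=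
  degenerateSet V ∪ crossingSet V ∪ zeroSet V

/-- The space `D ⊕ D` of pairs `Ψ = (Ψ⁰, Ψ¹)` of finitely supported `ℝ^n`-valued functions
on `ℤ^d`. -/
abbrev TestSpace (d n : ℕ) : Type :=
  ((Fin d → ℤ) →₀ (Fin n → ℝ)) × ((Fin d → ℤ) →₀ (Fin n → ℝ))

/-- The Fourier transform of a finitely supported function,
`ψ̂(θ) = ∑_z ψ(z) exp (i z · θ)`. -/
def fourierComponent (ψ : (Fin d → ℤ) →₀ (Fin n → ℝ)) (θ : Fin d → ℝ) : Fin n → ℂ :=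
  fun k => ∑ z ∈ ψ.support, (ψ z k : ℂ) * character z θ

/-- `Ψ̂(θ) = (Ψ̂⁰(θ), Ψ̂¹(θ)) ∈ ℂ^n ⊕ ℂ^n`. -/
def Psihat (Ψ : TestSpace d n) (θ : Fin d → ℝ) : Fin n ⊕ Fin n → ℂ :=
  Sum.elim (fourierComponent Ψ.1 θ) (fourierComponent Ψ.2 θ)

/-- The generator of the dual dynamics in the Fourier representation,
with the block rows `(0, -V̂(θ))` and `(1, 0)`. -/
def dualGenerator (V : (Fin d → ℤ) → Matrix (Fin n) (Fin n) ℝ) (θ : Fin d → ℝ) :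
    Matrix (Fin n ⊕ Fin n) (Fin n ⊕ Fin n) ℂ :=
  Matrix.fromBlocks 0 (-(Vhat V θ)) 1 0

/-- The dual Green function in the Fourier representation, `exp (t Â*(θ))`. -/
def dualGreen (V : (Fin d → ℤ) → Matrix (Fin n) (Fin n) ℝ) (t : ℝ) (θ : Fin d → ℝ) :
    Matrix (Fin n ⊕ Fin n) (Fin n ⊕ Fin n) ℂ :=
  NormedSpace.exp ((t : ℂ) • dualGenerator V θ)

/-- A fundamental cell of the torus `ℝ^d / 2πℤ^d`. -/
def cell (d : ℕ) : Set (Fin d → ℝ) := Set.univ.pi fun _ => Set.Ioc (-Real.pi) Real.pi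

/-- `g` is `2π`-periodic in each variable, that is, a function on the torus `ℝ^d / 2πℤ^d`. -/
def TorusPeriodic (g : (Fin d → ℝ) → ℂ) : Prop :=
  ∀ (θ : Fin d → ℝ) (m : Fin d → ℤ), g (fun i => θ i + 2 * Real.pi * (m i : ℝ)) = g θ

/-- The truncated dual solution
`Φ_g(x,t) = (2π)^{-d} ∫_{𝕋^d} exp (-i θ · x) exp (t Â*(θ)) g(θ) Ψ̂(θ) dθ`. -/
def truncatedDual (V : (Fin d → ℤ) → Matrix (Fin n) (Fin n) ℝ) (g : (Fin d → ℝ) → ℂ)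
    (Ψ : TestSpace d n) (x : Fin d → ℤ) (t : ℝ) : EuclideanSpace ℂ (Fin n ⊕ Fin n) :=
  (((2 * Real.pi) ^ d)⁻¹ : ℝ) • ∫ θ in cell d,
    (Complex.exp (-(Complex.I * (pairing θ x : ℂ))) * g θ) •
      WithLp.toLp 2 (dualGreen V t θ *ᵥ Psihat Ψ θ)

end HarmonicCrystal

end

/-! ### Families of functions with bounded directional derivatives -/

/-! Away from the critical set, `V̂ = B diag(w_k²) B*` locally, with smooth nonvanishing `w_k` and
unitary `B`. The generator is then diagonalizable with eigenvalues `±i w_k`, so after a smooth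
partition each component of the truncated solution is a finite sum of integrals `∫ exp (i (t u - L))
a`. Here `u = ±w_k`, the linear form `L` is `θ ↦ θ · x`, and the amplitude `a` is smooth and
compactly supported (`exists_local_representation`, `truncatedDual_component_bounds`). Both bounds
come from integration by parts along one fixed direction, uniformly in a family of phases
(`nonstationary_phase`).

Part i) needs a bound uniform in `L`, and stationary points are avoided by squaring: `|∫ F|²` is at
most the integral over `v` of `|∫ F (x + v) conj (F x) dx|`. The linear form now contributes only
the unimodular constant `exp (-i L v)`. The remaining phase `t (u (x + v) - u x)` has gradient at
least of size `|t| ‖v‖`, because the Hessian of `u` is invertible. The inner integral is therefore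
`O((1 + ‖t v‖)^(-d-1))`; integrating in `v` gives `|t|^(-d)`, and the square root gives the claim
(`correlation_decay`, `stationary_decay`).

Part ii) is the case where `L` dominates `t du`: the phase has no critical point, and repeated
integration by parts gains any power of `‖L‖` (`fast_decay`). The threshold depends on the phases
only, hence not on `Ψ`. -/

namespace OscillatoryIntegral

section Families

variable {P E : Type*} [NormedAddCommGroup E] [NormedSpace ℝ E]

/-- The derivatives of the members of a family `f`, each in its own direction. -/
noncomputable def dirDeriv (w : P → E) (f : P → E → ℂ) : P → E → ℂ :=
  fun p x => fderiv ℝ (f p) x (w p)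

/-- The iterated directional derivatives up to order `k` are bounded on `W`, uniformly in the
family. -/
def BoundedDerivs (W : Set E) (w : P → E) : ℕ → (P → E → ℂ) → Prop
  | 0, f => ∃ C : ℝ, ∀ p, ∀ x ∈ W, ‖f p x‖ ≤ C
  | k + 1, f => (∃ C : ℝ, ∀ p, ∀ x ∈ W, ‖f p x‖ ≤ C) ∧ BoundedDerivs W w k (dirDeriv w f)

variable {W : Set E} {w : P → E} {f g : P → E → ℂ}

theorem BoundedDerivs.bound {k : ℕ} (h : BoundedDerivs W w k f) :
    ∃ C : ℝ, ∀ p, ∀ x ∈ W, ‖f p x‖ ≤ C := by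
  cases k with
  | zero => exact h
  | succ k => exact h.1

theorem BoundedDerivs.of_succ {k : ℕ} : ∀ {f : P → E → ℂ}, BoundedDerivs W w (k + 1) f →
    BoundedDerivs W w k f := by
  induction k with
  | zero => intro f h; exact h.1
  | succ k ih => intro f h; exact ⟨h.1, ih h.2⟩

theorem BoundedDerivs.congr (hW : IsOpen W) {k : ℕ} : ∀ {f g : P → E → ℂ},
    BoundedDerivs W w k f → (∀ p, Set.EqOn (g p) (f p) W) → BoundedDerivs W w k g := by
  have key : ∀ {f g : P → E → ℂ}, (∃ C : ℝ, ∀ p, ∀ x ∈ W, ‖f p x‖ ≤ C) →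
      (∀ p, Set.EqOn (g p) (f p) W) → (∃ C : ℝ, ∀ p, ∀ x ∈ W, ‖g p x‖ ≤ C) := by
    rintro f g ⟨C, hC⟩ h
    exact ⟨C, fun p x hx => by rw [h p hx]; exact hC p x hx⟩
  induction k with
  | zero => intro f g hf h; exact key hf h
  | succ k ih =>
    intro f g hf h
    refine ⟨key hf.1 h, ih hf.2 fun p x hx => ?_⟩
    have : g p =ᶠ[nhds x] f p := Filter.eventuallyEq_of_mem (hW.mem_nhds hx) (h p)
    simp only [dirDeriv, this.fderiv_eq]

theorem contDiffOn_dirDeriv (hW : IsOpen W) (hf : ∀ p, ContDiffOn ℝ ∞ (f p) W) (p : P) :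
    ContDiffOn ℝ ∞ (dirDeriv w f p) W :=
  ((hf p).fderiv_of_isOpen hW (by simp)).clm_apply contDiffOn_const

theorem contDiff_dirDeriv (hf : ∀ p, ContDiff ℝ ∞ (f p)) (p : P) :
    ContDiff ℝ ∞ (dirDeriv w f p) :=
  ((hf p).fderiv_right (by simp)).clm_apply contDiff_const

theorem differentiableAt_of_contDiffOn {F : Type*} [NormedAddCommGroup F] [NormedSpace ℝ F]
    {u : E → F} (hW : IsOpen W) (hu : ContDiffOn ℝ ∞ u W)
    {x : E} (hx : x ∈ W) : DifferentiableAt ℝ u x :=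
  (hu.contDiffAt (hW.mem_nhds hx)).differentiableAt (by simp)

theorem BoundedDerivs.add (hW : IsOpen W) {k : ℕ} : ∀ {f g : P → E → ℂ},
    (∀ p, ContDiffOn ℝ ∞ (f p) W) → (∀ p, ContDiffOn ℝ ∞ (g p) W) →
    BoundedDerivs W w k f → BoundedDerivs W w k g →
    BoundedDerivs W w k (fun p x => f p x + g p x) := by
  have key : ∀ {f g : P → E → ℂ}, (∃ C : ℝ, ∀ p, ∀ x ∈ W, ‖f p x‖ ≤ C) →
      (∃ C : ℝ, ∀ p, ∀ x ∈ W, ‖g p x‖ ≤ C) →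
      (∃ C : ℝ, ∀ p, ∀ x ∈ W, ‖f p x + g p x‖ ≤ C) := by
    rintro f g ⟨C, hC⟩ ⟨D, hD⟩
    exact ⟨C + D, fun p x hx => (norm_add_le _ _).trans (add_le_add (hC p x hx) (hD p x hx))⟩
  induction k with
  | zero => intro f g _ _ hf hg; exact key hf hg
  | succ k ih =>
    intro f g sf sg hf hg
    refine ⟨key hf.1 hg.1, (ih (contDiffOn_dirDeriv hW sf) (contDiffOn_dirDeriv hW sg)
      hf.2 hg.2).congr hW fun p x hx => ?_⟩
    simp only [dirDeriv]
    rw [fderiv_fun_add (differentiableAt_of_contDiffOn hW (sf p) hx)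
      (differentiableAt_of_contDiffOn hW (sg p) hx)]
    rfl

theorem BoundedDerivs.mul (hW : IsOpen W) {k : ℕ} : ∀ {f g : P → E → ℂ},
    (∀ p, ContDiffOn ℝ ∞ (f p) W) → (∀ p, ContDiffOn ℝ ∞ (g p) W) →
    BoundedDerivs W w k f → BoundedDerivs W w k g →
    BoundedDerivs W w k (fun p x => f p x * g p x) := by
  have key : ∀ {f g : P → E → ℂ}, (∃ C : ℝ, ∀ p, ∀ x ∈ W, ‖f p x‖ ≤ C) →
      (∃ C : ℝ, ∀ p, ∀ x ∈ W, ‖g p x‖ ≤ C) →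
      (∃ C : ℝ, ∀ p, ∀ x ∈ W, ‖f p x * g p x‖ ≤ C) := by
    rintro f g ⟨C, hC⟩ ⟨D, hD⟩
    exact ⟨C * D, fun p x hx => (norm_mul_le _ _).trans
      (mul_le_mul (hC p x hx) (hD p x hx) (norm_nonneg _) ((norm_nonneg _).trans (hC p x hx)))⟩
  induction k with
  | zero => intro f g _ _ hf hg; exact key hf hg
  | succ k ih =>
    intro f g sf sg hf hg
    have dsf := contDiffOn_dirDeriv (w := w) hW sf
    have dsg := contDiffOn_dirDeriv (w := w) hW sg
    refine ⟨key hf.1 hg.1, (BoundedDerivs.add hW (fun p => (sf p).mul (dsg p))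
      (fun p => (sg p).mul (dsf p)) (ih sf dsg hf.of_succ hg.2)
      (ih sg dsf hg.of_succ hf.2)).congr hW fun p x hx => ?_⟩
    simp only [dirDeriv]
    rw [fderiv_fun_mul (differentiableAt_of_contDiffOn hW (sf p) hx)
      (differentiableAt_of_contDiffOn hW (sg p) hx)]
    simp

theorem boundedDerivs_const {c : P → ℂ} {C : ℝ} (hc : ∀ p, ‖c p‖ ≤ C) {k : ℕ} :
    BoundedDerivs W w k (fun p _ => c p) := by
  have zero : ∀ k, BoundedDerivs W w k (fun _ _ => (0 : ℂ)) := by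
    intro k
    induction k with
    | zero => exact ⟨0, by simp⟩
    | succ k ih => exact ⟨⟨0, by simp⟩, by
        have h : dirDeriv w (fun (_ : P) (_ : E) => (0 : ℂ)) = fun _ _ => 0 := by
          ext p x; simp [dirDeriv]
        rw [h]; exact ih⟩
  cases k with
  | zero => exact ⟨C, fun p _ _ => hc p⟩
  | succ k => exact ⟨⟨C, fun p _ _ => hc p⟩, by
      have h : dirDeriv w (fun (p : P) (_ : E) => c p) = fun _ _ => 0 := by
        ext p x; simp [dirDeriv]
      rw [h]; exact zero k⟩

/-- The derivative of `1/f` is `-f⁻² Df`, so each order follows from the previous one by the product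
rule. -/
theorem BoundedDerivs.inv (hW : IsOpen W) {c : ℝ} (hc : 0 < c)
    (sf : ∀ p, ContDiffOn ℝ ∞ (f p) W) (hf : ∀ k, BoundedDerivs W w k f)
    (hfc : ∀ p, ∀ x ∈ W, c ≤ ‖f p x‖) (k : ℕ) :
    BoundedDerivs W w k (fun p x => (f p x)⁻¹) := by
  have h0 : ∀ p, ∀ x ∈ W, f p x ≠ 0 := fun p x hx => norm_pos_iff.1 (hc.trans_le (hfc p x hx))
  have hb : ∃ C : ℝ, ∀ p, ∀ x ∈ W, ‖(f p x)⁻¹‖ ≤ C := ⟨c⁻¹, fun p x hx => by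
    rw [norm_inv]; exact inv_anti₀ hc (hfc p x hx)⟩
  have si : ∀ p, ContDiffOn ℝ ∞ (fun x => (f p x)⁻¹) W := fun p => (sf p).inv (h0 p)
  induction k with
  | zero => exact hb
  | succ k ih =>
    have ds := contDiffOn_dirDeriv (w := w) hW sf
    refine ⟨hb, (BoundedDerivs.mul hW (fun p => contDiffOn_const) (fun p => ((si p).mul (si p)).mul
      (ds p)) (boundedDerivs_const (c := fun _ => -1) (C := 1) (by simp))
      (BoundedDerivs.mul hW (fun p => (si p).mul (si p)) ds (BoundedDerivs.mul hW si si ih ih)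
        (hf (k + 1)).2)).congr hW fun p x hx => ?_⟩
    have hd := (differentiableAt_of_contDiffOn hW (sf p) hx).hasFDerivAt
    have := ((hasDerivAt_inv (h0 p x hx)).comp_hasFDerivAt_of_eq x (hd.restrictScalars ℝ) rfl)
    simp only [dirDeriv]
    have h2 : HasFDerivAt (fun y => (f p y)⁻¹) ((-((f p x) ^ 2)⁻¹) • fderiv ℝ (f p) x) x := this
    rw [h2.fderiv]
    simp only [FunLike.coe_smul, Pi.smul_apply, smul_eq_mul]
    rw [pow_two, mul_inv]
    ring

/-- Since the directions have norm at most one, a directional derivative costs one order of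
differentiation and no constant. -/
theorem boundedDerivs_of_iteratedFDeriv (hw : ∀ p, ‖w p‖ ≤ 1) {k : ℕ} : ∀ {f : P → E → ℂ},
    (∀ p, ContDiff ℝ ∞ (f p)) → (∀ m, ∃ C : ℝ, ∀ p x, ‖iteratedFDeriv ℝ m (f p) x‖ ≤ C) →
    BoundedDerivs W w k f := by
  have h0 : ∀ {f : P → E → ℂ}, (∀ m, ∃ C : ℝ, ∀ p x, ‖iteratedFDeriv ℝ m (f p) x‖ ≤ C) →
      ∃ C : ℝ, ∀ p, ∀ x ∈ W, ‖f p x‖ ≤ C := by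
    intro f hf
    obtain ⟨C, hC⟩ := hf 0
    exact ⟨C, fun p x _ => by simpa using hC p x⟩
  induction k with
  | zero => intro f _ hf; exact h0 hf
  | succ k ih =>
    intro f sf hf
    refine ⟨h0 hf, ih (contDiff_dirDeriv sf) fun m => ?_⟩
    obtain ⟨C, hC⟩ := hf (m + 1)
    refine ⟨C, fun p x => ?_⟩
    have sd : ContDiff ℝ ∞ (fderiv ℝ (f p)) := (sf p).fderiv_right (by simp)
    have h1 := norm_iteratedFDeriv_clm_apply_const (𝕜 := ℝ) (f := fderiv ℝ (f p)) (c := w p)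
      (x := x) (N := ∞) (n := m) sd.contDiffAt (by exact_mod_cast le_top)
    rw [norm_iteratedFDeriv_fderiv] at h1
    exact h1.trans ((mul_le_of_le_one_left (norm_nonneg _) (hw p)).trans (hC p x))

end Families

/-- Off the closed support of `a` the product vanishes locally, whatever values `f` takes there. -/
theorem contDiff_mul_of_tsupport_subset {A F : Type*} [NormedRing A] [NormedAlgebra ℝ A]
    [NormedAddCommGroup F] [NormedSpace ℝ F] {a f : F → A} {U : Set F} (hU : IsOpen U)
    (ha : ContDiff ℝ ∞ a) (hf : ContDiffOn ℝ ∞ f U) (h : tsupport a ⊆ U) :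
    ContDiff ℝ ∞ (fun x => a x * f x) := by
  refine contDiff_iff_contDiffAt.2 fun x => ?_
  by_cases hx : x ∈ tsupport a
  · exact ha.contDiffAt.mul (hf.contDiffAt (hU.mem_nhds (h hx)))
  · refine (contDiffAt_const (c := (0 : A))).congr_of_eventuallyEq ?_
    filter_upwards [notMem_tsupport_iff_eventuallyEq.1 hx] with y hy
    simp [hy]

/-! ### Oscillatory integrals without critical points. -/

section NonstationaryPhase

variable {P E : Type*} [NormedAddCommGroup E] [NormedSpace ℝ E] [FiniteDimensional ℝ E]
  [MeasurableSpace E] [BorelSpace E] (μ : Measure E) [μ.IsAddHaarMeasure]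

theorem integral_fderiv_eq_zero {u : E → ℂ} (hu : ContDiff ℝ ∞ u) (hc : HasCompactSupport u)
    (v : E) : ∫ x, fderiv ℝ u x v ∂μ = 0 := by
  have hd : Integrable (fun x => fderiv ℝ u x v) μ :=
    ((hu.continuous_fderiv (by simp)).clm_apply continuous_const).integrable_of_hasCompactSupport
      (hc.fderiv_apply ℝ v)
  have hi : Integrable u μ := hu.continuous.integrable_of_hasCompactSupport hc
  have := integral_mul_fderiv_eq_neg_fderiv_mul_of_integrable (𝕜 := ℂ) (μ := μ) (f := fun _ => (1:ℂ))
    (g := u) (v := v) (by simp) (by simpa using hd) (by simpa using hi)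
    (fun x => by simp) (fun x _ => hu.differentiable (by simp) x)
  simpa using this

/-- Repeated integration by parts for a family of oscillatory integrals whose phases have no
critical point. -/
theorem nonstationary_phase {W : Set E} (hW : IsOpen W) (hWμ : μ W ≠ ⊤) {w : P → E}
    {φ : P → E → ℂ} (hφ : ∀ p, ContDiff ℝ ∞ (φ p)) (hφr : ∀ p x, (φ p x).im = 0)
    {c : ℝ} (hc : 0 < c) (hφc : ∀ p, ∀ x ∈ W, c ≤ ‖dirDeriv w φ p x‖)
    (hφb : ∀ k, BoundedDerivs W w k (dirDeriv w φ)) (N : ℕ) :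
    ∀ a : P → E → ℂ, (∀ p, ContDiff ℝ ∞ (a p)) → (∀ p, HasCompactSupport (a p)) →
      (∀ p, tsupport (a p) ⊆ W) → (∀ k, BoundedDerivs W w k a) →
      ∃ C : ℝ, ∀ p, ∀ l : ℝ, l ≠ 0 →
        ‖∫ x, Complex.exp (Complex.I * l * φ p x) * a p x ∂μ‖ ≤ C * (|l| ^ N)⁻¹ := by
  have hexp : ∀ p x (l : ℝ), ‖Complex.exp (Complex.I * l * φ p x)‖ = 1 := by
    intro p x l
    rw [Complex.norm_exp]
    simp [hφr p x]
  -- The amplitude stays quantified: each integration by parts replaces `a` by the `w`-derivative of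
  -- `a / D_w φ` and gains a factor `|l|⁻¹`.
  induction N with
  | zero =>
    intro a _ _ hs hb
    obtain ⟨C, hC⟩ := (hb 0).bound
    refine ⟨C * μ.real W, fun p l _ => ?_⟩
    rw [← setIntegral_eq_integral_of_forall_compl_eq_zero (s := W)]
    · simp only [pow_zero, inv_one, mul_one]
      refine norm_setIntegral_le_of_norm_le_const hWμ.lt_top fun x hx => ?_
      rw [norm_mul, hexp, one_mul]
      exact hC p x hx
    · intro x hx
      rw [image_eq_zero_of_notMem_tsupport fun h => hx (hs p h), mul_zero]
  | succ N ih =>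
    intro a sa ca ta ba
    have sD := contDiff_dirDeriv (w := w) hφ
    have hD0 : ∀ p, ∀ x ∈ W, dirDeriv w φ p x ≠ 0 := fun p x hx =>
      norm_pos_iff.1 (hc.trans_le (hφc p x hx))
    set b : P → E → ℂ := fun p x => a p x * (dirDeriv w φ p x)⁻¹ with hbdef
    have sb : ∀ p, ContDiff ℝ ∞ (b p) := fun p =>
      contDiff_mul_of_tsupport_subset hW (sa p) ((sD p).contDiffOn.inv (hD0 p)) (ta p)
    have tb : ∀ p, tsupport (b p) ⊆ tsupport (a p) := fun p => tsupport_mul_subset_left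
    have cb : ∀ p, HasCompactSupport (b p) := fun p => (ca p).mul_right
    have bb : ∀ k, BoundedDerivs W w k b := fun k =>
      BoundedDerivs.mul hW (fun p => (sa p).contDiffOn) (fun p => (sD p).contDiffOn.inv (hD0 p))
        (ba k) (BoundedDerivs.inv hW hc (fun p => (sD p).contDiffOn) hφb hφc k)
    obtain ⟨C, hC⟩ := ih (dirDeriv w b) (contDiff_dirDeriv sb)
      (fun p => (cb p).fderiv_apply ℝ (w p))
      (fun p => ((tsupport_fderiv_apply_subset ℝ (w p)).trans (tb p)).trans (ta p))
      (fun k => (bb (k + 1)).2)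
    refine ⟨C, fun p l hl => ?_⟩
    have se : ContDiff ℝ ∞ (fun x => Complex.exp (Complex.I * l * φ p x)) :=
      (contDiff_const.mul (hφ p)).cexp
    have hz := integral_fderiv_eq_zero μ (se.mul (sb p)) (cb p).mul_left (w p)
    have hpt : ∀ x, fderiv ℝ (fun x => Complex.exp (Complex.I * l * φ p x) * b p x) x (w p)
        = Complex.I * l * (Complex.exp (Complex.I * l * φ p x) * a p x)
          + Complex.exp (Complex.I * l * φ p x) * dirDeriv w b p x := by
      intro x
      have h1 : HasFDerivAt (φ p) (fderiv ℝ (φ p) x) x :=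
        ((hφ p).differentiable (by simp) x).hasFDerivAt
      have h2 : HasFDerivAt (b p) (fderiv ℝ (b p) x) x :=
        ((sb p).differentiable (by simp) x).hasFDerivAt
      have h0 := (h1.const_mul (Complex.I * l)).cexp.mul h2
      have h0' : fderiv ℝ (fun x => Complex.exp (Complex.I * l * φ p x) * b p x) x = _ := h0.fderiv
      rw [h0']
      have h3 : a p x = b p x * dirDeriv w φ p x := by
        by_cases hx : x ∈ W
        · simp only [hbdef]
          field_simp [hD0 p x hx]
        · have : a p x = 0 := image_eq_zero_of_notMem_tsupport fun h => hx (ta p h)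
          simp [hbdef, this]
      rw [h3]
      simp only [dirDeriv, FunLike.coe_add, FunLike.coe_smul, Pi.add_apply, Pi.smul_apply,
        smul_eq_mul]
      ring
    rw [integral_congr_ae (Filter.Eventually.of_forall hpt), integral_add, integral_const_mul] at hz
    · have h4 : ∫ x, Complex.exp (Complex.I * l * φ p x) * a p x ∂μ
          = -(Complex.I * l)⁻¹ * ∫ x, Complex.exp (Complex.I * l * φ p x) * dirDeriv w b p x ∂μ := by
        have hl' : (Complex.I * l) ≠ 0 := by simp [hl]
        field_simp
        linear_combination hz
      rw [h4, norm_mul, norm_neg, norm_inv, norm_mul, Complex.norm_I, one_mul, Complex.norm_real,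
        Real.norm_eq_abs, pow_succ, mul_inv, ← mul_assoc, mul_comm]
      exact mul_le_mul_of_nonneg_right (hC p l hl) (by positivity)
    · exact ((continuous_const.mul (se.continuous.mul (sa p).continuous))).integrable_of_hasCompactSupport
        (ca p).mul_left.mul_left
    · exact (se.continuous.mul (contDiff_dirDeriv sb p).continuous).integrable_of_hasCompactSupport
        ((cb p).fderiv_apply ℝ (w p)).mul_left

end NonstationaryPhase


/-- Merges the trivial bound with the decay bound by means of `(1 + s)^N ≤ 2^N (1 + s^N)`. -/
theorem le_mul_inv_one_add_pow {y s A B : ℝ} {N : ℕ} (hy : 0 ≤ y) (hs : 0 ≤ s) (hA : y ≤ A)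
    (hB : s ≠ 0 → y ≤ B * (s ^ N)⁻¹) : y ≤ 2 ^ N * (2 * A + |B|) * ((1 + s) ^ N)⁻¹ := by
  rw [← div_eq_mul_inv, le_div_iff₀ (by positivity)]
  have h1 : (1 + s) ^ N ≤ 2 ^ N * (1 + s ^ N) := by
    refine (add_pow_le zero_le_one hs N).trans ?_
    rw [one_pow]
    gcongr
    · norm_num
    · omega
  have h2 : y * s ^ N ≤ A + |B| := by
    rcases eq_or_ne s 0 with rfl | h
    · rcases N with _ | N
      · simpa using hA.trans (le_add_of_nonneg_right (abs_nonneg B))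
      · simpa using add_nonneg (hy.trans hA) (abs_nonneg B)
    · have := hB h
      rw [← div_eq_mul_inv, le_div_iff₀ (by positivity)] at this
      linarith [le_abs_self B]
  calc y * (1 + s) ^ N ≤ y * (2 ^ N * (1 + s ^ N)) := by gcongr
    _ = 2 ^ N * (y + y * s ^ N) := by ring
    _ ≤ 2 ^ N * (A + (A + |B|)) := by gcongr
    _ = 2 ^ N * (2 * A + |B|) := by ring

theorem norm_exp_I_mul_ofReal (r : ℝ) : ‖Complex.exp (Complex.I * r)‖ = 1 := by
  rw [mul_comm]; exact Complex.norm_exp_ofReal_mul_I r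

/-! ### Difference quotients, gradients and near-norming directions. -/

section Calculus

variable {E F : Type*} [NormedAddCommGroup E] [NormedSpace ℝ E]
  [NormedAddCommGroup F] [NormedSpace ℝ F]

theorem exists_bound_iteratedFDeriv {f : E → F} (hf : ContDiff ℝ ∞ f) (hc : HasCompactSupport f)
    (m : ℕ) : ∃ C : ℝ, ∀ x, ‖iteratedFDeriv ℝ m f x‖ ≤ C :=
  (hc.iteratedFDeriv m).exists_bound_of_continuous
    (hf.continuous_iteratedFDeriv (by exact_mod_cast le_top))

theorem contDiff_ofReal_comp {u : E → ℝ} (hu : ContDiff ℝ ∞ u) :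
    ContDiff ℝ ∞ (fun x => (u x : ℂ)) :=
  Complex.ofRealCLM.contDiff.comp hu

theorem fderiv_ofReal_comp {u : E → ℝ} {x : E} (hu : DifferentiableAt ℝ u x) (v : E) :
    fderiv ℝ (fun y => (u y : ℂ)) x v = (fderiv ℝ u x v : ℂ) := by
  have h : HasFDerivAt (fun y => (u y : ℂ)) _ x :=
    (Complex.ofRealCLM.hasFDerivAt (x := u x)).comp x hu.hasFDerivAt
  rw [h.fderiv]; rfl

/-- The mean value inequality; the factor `‖h‖` keeps the phases `(u (x + h) - u x) / ‖h‖` bounded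
in every derivative as `h → 0`. -/
theorem norm_iteratedFDeriv_add_sub_le {f : E → F} (hf : ContDiff ℝ ∞ f) (m : ℕ) {C : ℝ}
    (hC : ∀ x, ‖iteratedFDeriv ℝ (m + 1) f x‖ ≤ C) (x h : E) :
    ‖iteratedFDeriv ℝ m (fun y => f (y + h) - f y) x‖ ≤ C * ‖h‖ := by
  have h1 : iteratedFDeriv ℝ m (fun y => f (y + h) - f y) x
      = iteratedFDeriv ℝ m f (x + h) - iteratedFDeriv ℝ m f x := by
    have hm : ((m : ℕ) : WithTop ℕ∞) ≤ ∞ := by exact_mod_cast le_top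
    change iteratedFDeriv ℝ m ((fun y => f (y + h)) - f) x = _
    rw [iteratedFDeriv_sub_apply (f := fun y => f (y + h))
      ((hf.comp (contDiff_id.add contDiff_const)).of_le hm).contDiffAt (hf.of_le hm).contDiffAt,
      iteratedFDeriv_comp_add_right]
  rw [h1]
  have := Convex.norm_image_sub_le_of_norm_fderiv_le (𝕜 := ℝ) (f := iteratedFDeriv ℝ m f)
    (s := Set.univ) (C := C) (x := x) (y := x + h)
    (fun y _ => (hf.differentiable_iteratedFDeriv (by exact_mod_cast ENat.natCast_lt_top m)) y)
    (fun y _ => by rw [norm_fderiv_iteratedFDeriv]; exact hC y) convex_univ trivial trivial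
  simpa using this

theorem exists_pos_mul_norm_le [FiniteDimensional ℝ E]
    (H : E →L[ℝ] F) (hH : ∀ h, H h = 0 → h = 0) :
    ∃ c > 0, ∀ h, c * ‖h‖ ≤ ‖H h‖ := by
  obtain ⟨K, hK, hA⟩ := (H : E →ₗ[ℝ] F).exists_antilipschitzWith
    (LinearMap.ker_eq_bot'.2 hH)
  refine ⟨(K : ℝ)⁻¹, by positivity, fun h => ?_⟩
  have := hA.le_mul_dist h 0
  simp only [dist_zero_right, map_zero] at this
  rw [inv_mul_le_iff₀ (by positivity)]
  exact this

theorem exists_norm_le_one_half_le (L : F →L[ℝ] ℝ) : ∃ w : F, ‖w‖ ≤ 1 ∧ ‖L‖ / 2 ≤ ‖L w‖ := by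
  rcases eq_or_ne L 0 with rfl | h
  · exact ⟨0, by simp⟩
  · have : 0 < ‖L‖ := norm_pos_iff.2 h
    obtain ⟨w, hw, h2⟩ := L.exists_lt_apply_of_lt_opNorm (half_lt_self this)
    exact ⟨w, hw.le, h2.le⟩

/-- Difference quotients of the gradient of `u` are bounded below near a point with
nondegenerate Hessian. -/
theorem exists_fderiv_sub_lower_bound [FiniteDimensional ℝ E] {u : E → ℝ} (hu : ContDiff ℝ ∞ u)
    {x₀ : E} (hH : ∀ h, fderiv ℝ (fderiv ℝ u) x₀ h = 0 → h = 0) :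
    ∃ c > 0, ∃ δ > 0, ∀ h : E, ∃ w : E, ‖w‖ ≤ 1 ∧ ∀ x ∈ Metric.ball x₀ δ,
      x + h ∈ Metric.ball x₀ δ → c * ‖h‖ ≤ ‖fderiv ℝ u (x + h) w - fderiv ℝ u x w‖ := by
  set H := fderiv ℝ (fderiv ℝ u) x₀ with hHdef
  obtain ⟨c, hc, hcH⟩ := exists_pos_mul_norm_le H hH
  have hs : HasStrictFDerivAt (fderiv ℝ u) H x₀ :=
    (hu.fderiv_right (m := ∞) (by simp)).hasStrictFDerivAt (by simp)
  -- The direction `w` chosen below depends on `h` but not on `x`. It gives `‖H h w‖ ≥ c/2 ‖h‖`, of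
  -- which strict differentiability at `x₀` loses at most `c/4 ‖h‖`.
  have hl := hs.isLittleO.def (show 0 < c / 4 by positivity)
  rw [nhds_prod_eq, Filter.eventually_prod_iff] at hl
  obtain ⟨p1, h1, p2, h2, h3⟩ := hl
  obtain ⟨δ, hδ, hb⟩ := Metric.eventually_nhds_iff_ball.1 (h1.and h2)
  refine ⟨c / 4, by positivity, δ, hδ, fun h => ?_⟩
  obtain ⟨w, hw, hwH⟩ := exists_norm_le_one_half_le (H h)
  refine ⟨w, hw, fun x hx hxh => ?_⟩
  have h4 := h3 (hb _ hxh).1 (hb _ hx).2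
  simp only [add_sub_cancel_left] at h4
  have h5 : ‖(fderiv ℝ u (x + h) - fderiv ℝ u x - H h) w‖ ≤ c / 4 * ‖h‖ := by
    refine (ContinuousLinearMap.le_opNorm _ _).trans ((mul_le_of_le_one_right ?_ hw).trans h4)
    exact norm_nonneg _
  simp only [FunLike.coe_sub, Pi.sub_apply] at h5
  have h6 := norm_sub_norm_le (H h w) (-(fderiv ℝ u (x + h) w - fderiv ℝ u x w - H h w))
  rw [norm_neg] at h6
  have h7 : H h w - -(fderiv ℝ u (x + h) w - fderiv ℝ u x w - H h w)
    = fderiv ℝ u (x + h) w - fderiv ℝ u x w := by ring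
  rw [h7] at h6
  have := hcH h
  linarith

end Calculus

/-! ### Stationary and rapid decay of oscillatory integrals. -/

section Decay

variable {E : Type*} [NormedAddCommGroup E] [NormedSpace ℝ E] [FiniteDimensional ℝ E]
  [MeasurableSpace E] [BorelSpace E] (μ : Measure E) [μ.IsAddHaarMeasure]

/-- The square of an integral is bounded by an integral of correlations. -/
theorem norm_integral_sq_le {F : E → ℂ} (hF : Integrable F μ) {b : E → ℝ} (hb : Integrable b μ)
    (h : ∀ v, ‖∫ x, F (x + v) * (starRingEnd ℂ) (F x) ∂μ‖ ≤ b v) :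
    ‖∫ x, F x ∂μ‖ ^ 2 ≤ ∫ v, b v ∂μ := by
  have hFc : Integrable (fun x => (starRingEnd ℂ) (F x)) μ :=
    (Complex.conjCLE : ℂ →L[ℝ] ℂ).integrable_comp hF
  -- The shear `(x, v) ↦ (x, x + v)` preserves the product measure, which justifies Fubini.
  have hprod : Integrable (fun z : E × E => (starRingEnd ℂ) (F z.1) * F (z.1 + z.2)) (μ.prod μ) :=
    (measurePreserving_prod_add μ μ).integrable_comp_of_integrable (hFc.mul_prod hF)
  have h1 : (∫ x, F x ∂μ) * (starRingEnd ℂ) (∫ x, F x ∂μ)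
      = ∫ v, ∫ x, F (x + v) * (starRingEnd ℂ) (F x) ∂μ ∂μ := by
    have h2 : ∫ x, ∫ v, (starRingEnd ℂ) (F x) * F (x + v) ∂μ ∂μ
        = (∫ x, (starRingEnd ℂ) (F x) ∂μ) * ∫ x, F x ∂μ := by
      simp only [integral_const_mul, integral_add_left_eq_self]
      rw [integral_mul_const]
    rw [integral_integral_swap hprod, integral_conj] at h2
    rw [mul_comm, ← h2]
    simp only [mul_comm]
  have h3 : ‖∫ x, F x ∂μ‖ ^ 2 = ‖∫ v, ∫ x, F (x + v) * (starRingEnd ℂ) (F x) ∂μ ∂μ‖ := by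
    rw [← h1, norm_mul, RCLike.norm_conj, sq]
  rw [h3]
  exact norm_integral_le_of_norm_le hb (Filter.Eventually.of_forall h)

/-- The phase is divided by `‖h‖` and `t ‖h‖` serves as the large parameter. The shifts `h` then
index a family with a uniform lower bound on the derivative of the phase. -/
theorem correlation_decay {u : E → ℝ} (hu : ContDiff ℝ ∞ u) (huc : HasCompactSupport u)
    {x₀ : E} (hH : ∀ h, fderiv ℝ (fderiv ℝ u) x₀ h = 0 → h = 0) :
    ∃ W, IsOpen W ∧ x₀ ∈ W ∧ ∀ a : E → ℂ, ContDiff ℝ ∞ a → HasCompactSupport a →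
      tsupport a ⊆ W → ∀ N : ℕ, ∃ C : ℝ, 0 ≤ C ∧ ∀ (t : ℝ) (h : E),
        ‖∫ x, Complex.exp (Complex.I * (t * (u (x + h) - u x) : ℝ)) *
          (a (x + h) * (starRingEnd ℂ) (a x)) ∂μ‖ ≤ C * ((1 + ‖t • h‖) ^ N)⁻¹ := by
  obtain ⟨c, hc, δ, hδ, hw⟩ := exists_fderiv_sub_lower_bound hu hH
  choose w hw1 hwl using hw
  -- If `‖h‖ < 2δ/3`, both `x` and `x + h` lie in the `δ`-ball; for larger shifts the two amplitudes
  -- have disjoint supports.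
  refine ⟨Metric.ball x₀ (δ / 3), Metric.isOpen_ball, Metric.mem_ball_self (by positivity),
    fun a sa ca ta N => ?_⟩
  set W := Metric.ball x₀ (δ / 3) with hWdef
  let P := {h : E // h ≠ 0 ∧ ‖h‖ < 2 * δ / 3}
  let φ : P → E → ℂ := fun p x => ((‖p.1‖⁻¹ * (u (x + p.1) - u x) : ℝ) : ℂ)
  let b : P → E → ℂ := fun p x => a (x + p.1) * (starRingEnd ℂ) (a x)
  have su : ∀ h : E, ContDiff ℝ ∞ (fun x => u (x + h)) := fun h =>
    hu.comp (contDiff_id.add contDiff_const)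
  have sφr : ∀ p : P, ContDiff ℝ ∞ (fun x => ‖p.1‖⁻¹ * (u (x + p.1) - u x)) := fun p =>
    contDiff_const.mul ((su p.1).sub hu)
  have sφ : ∀ p, ContDiff ℝ ∞ (φ p) := fun p => contDiff_ofReal_comp (sφr p)
  have hφd : ∀ p, ∀ x ∈ W, c ≤ ‖dirDeriv (fun p : P => w p.1) φ p x‖ := by
    intro p x hx
    have hp : 0 < ‖p.1‖ := norm_pos_iff.2 p.2.1
    have h1 : dirDeriv (fun p : P => w p.1) φ p x
        = ((‖p.1‖⁻¹ * (fderiv ℝ u (x + p.1) (w p.1) - fderiv ℝ u x (w p.1)) : ℝ) : ℂ) := by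
      simp only [dirDeriv, φ]
      rw [fderiv_ofReal_comp ((sφr p).differentiable (by simp) x),
        fderiv_const_mul (((su p.1).sub hu).differentiable (by simp) x),
        fderiv_fun_sub ((su p.1).differentiable (by simp) x) (hu.differentiable (by simp) x),
        fderiv_comp_add_right]
      rfl
    rw [h1, Complex.norm_real, norm_mul, norm_inv, norm_norm, inv_mul_eq_div, le_div_iff₀ hp]
    refine hwl p.1 x (Metric.ball_subset_ball (by linarith) hx) ?_
    rw [mem_ball_iff_norm] at hx ⊢
    calc ‖x + p.1 - x₀‖ = ‖(x - x₀) + p.1‖ := by congr 1; abel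
      _ ≤ ‖x - x₀‖ + ‖p.1‖ := norm_add_le _ _
      _ < δ / 3 + 2 * δ / 3 := add_lt_add hx p.2.2
      _ = δ := by ring
  have hφb : ∀ k, BoundedDerivs W (fun p : P => w p.1) k (dirDeriv (fun p : P => w p.1) φ) := by
    intro k
    refine (boundedDerivs_of_iteratedFDeriv (k := k + 1) (fun p : P => hw1 p.1) sφ fun m => ?_).2
    obtain ⟨C, hC⟩ := exists_bound_iteratedFDeriv (contDiff_ofReal_comp hu)
      (huc.comp_left (g := ((↑) : ℝ → ℂ)) (by simp)) (m + 1)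
    refine ⟨C, fun p x => ?_⟩
    have hp : 0 < ‖p.1‖ := norm_pos_iff.2 p.2.1
    have h1 : φ p = ((‖p.1‖⁻¹ : ℝ) : ℂ) • fun x => ((u (x + p.1) : ℂ) - (u x : ℂ)) := by
      ext x; simp [φ]
    have h2 : ContDiff ℝ ∞ (fun x => ((u (x + p.1) : ℂ) - (u x : ℂ))) :=
      (contDiff_ofReal_comp (su p.1)).sub (contDiff_ofReal_comp hu)
    rw [h1, iteratedFDeriv_const_smul_apply (h2.of_le (by exact_mod_cast le_top)).contDiffAt,
      norm_smul, Complex.norm_real, norm_inv, norm_norm, inv_mul_eq_div, div_le_iff₀ hp]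
    exact norm_iteratedFDeriv_add_sub_le (contDiff_ofReal_comp hu) m hC x p.1
  have sconj : ContDiff ℝ ∞ (fun x => (starRingEnd ℂ) (a x)) := Complex.conjCLE.contDiff.comp sa
  have cconj : HasCompactSupport (fun x => (starRingEnd ℂ) (a x)) := ca.comp_left (by simp)
  have tconj : tsupport (fun x => (starRingEnd ℂ) (a x)) ⊆ tsupport a :=
    closure_mono fun x hx => by
      rw [Function.mem_support] at hx ⊢
      exact fun h => hx (by simp [h])
  have sb1 : ∀ p : P, ContDiff ℝ ∞ (fun x => a (x + p.1)) := fun p =>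
    sa.comp (contDiff_id.add contDiff_const)
  have hbb : ∀ k, BoundedDerivs W (fun p : P => w p.1) k b := by
    intro k
    refine BoundedDerivs.mul (f := fun p x => a (x + p.1)) (g := fun p x => (starRingEnd ℂ) (a x))
      Metric.isOpen_ball (fun p => (sb1 p).contDiffOn)
      (fun p => sconj.contDiffOn) ?_ ?_
    · refine boundedDerivs_of_iteratedFDeriv (fun p : P => hw1 p.1) sb1 fun m => ?_
      obtain ⟨C, hC⟩ := exists_bound_iteratedFDeriv sa ca m
      exact ⟨C, fun p x => by rw [iteratedFDeriv_comp_add_right]; exact hC _⟩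
    · refine boundedDerivs_of_iteratedFDeriv (fun p : P => hw1 p.1) (fun p => sconj) fun m => ?_
      obtain ⟨C, hC⟩ := exists_bound_iteratedFDeriv sconj cconj m
      exact ⟨C, fun p x => hC _⟩
  obtain ⟨C₁, hC₁⟩ := nonstationary_phase μ (W := W) Metric.isOpen_ball measure_ball_lt_top.ne sφ
    (fun p x => Complex.ofReal_im _) hc hφd hφb N b (fun p => (sb1 p).mul sconj)
    (fun p => cconj.mul_left) (fun p => (tsupport_mul_subset_right.trans tconj).trans ta) hbb
  obtain ⟨M, hM⟩ := ca.exists_bound_of_continuous sa.continuous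
  have ia : Integrable (fun x => M * ‖a x‖) μ :=
    (sa.continuous.integrable_of_hasCompactSupport ca).norm.const_mul M
  set A := ∫ x, M * ‖a x‖ ∂μ with hA
  have hM0 : 0 ≤ M := (norm_nonneg _).trans (hM x₀)
  have hA0 : 0 ≤ A := integral_nonneg fun x => mul_nonneg hM0 (norm_nonneg _)
  refine ⟨2 ^ N * (2 * A + |C₁|), by positivity, fun t h => ?_⟩
  refine le_mul_inv_one_add_pow (B := C₁) (norm_nonneg _) (norm_nonneg _) ?_ ?_
  · refine norm_integral_le_of_norm_le ia (Filter.Eventually.of_forall fun x => ?_)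
    rw [norm_mul, norm_exp_I_mul_ofReal, one_mul, norm_mul, RCLike.norm_conj]
    exact mul_le_mul_of_nonneg_right (hM _) (norm_nonneg _)
  · intro hth
    have hth0 : t • h ≠ 0 := norm_ne_zero_iff.1 hth
    have ht : t ≠ 0 := fun h0 => hth0 (by simp [h0])
    have hh : h ≠ 0 := fun h0 => hth0 (by simp [h0])
    have hhn : ‖h‖ ≠ 0 := norm_ne_zero_iff.2 hh
    by_cases hs : ‖h‖ < 2 * δ / 3
    · have h1 := hC₁ ⟨h, hh, hs⟩ (t * ‖h‖) (mul_ne_zero ht hhn)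
      rw [abs_mul, abs_norm, ← Real.norm_eq_abs, ← norm_smul] at h1
      refine le_trans (le_of_eq ?_) h1
      congr 2
      ext x
      simp only [φ, b]
      congr 2
      rw [mul_assoc, ← Complex.ofReal_mul]
      congr 2
      field_simp
    · have h0 : ∀ x, a (x + h) * (starRingEnd ℂ) (a x) = 0 := by
        intro x
        by_contra hne
        have h1 : a (x + h) ≠ 0 := left_ne_zero_of_mul hne
        have h2 : a x ≠ 0 := fun h => hne (by simp [h])
        have h3 := mem_ball_iff_norm.1 (ta (subset_tsupport a h1))
        have h4 := mem_ball_iff_norm.1 (ta (subset_tsupport a h2))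
        apply hs
        calc ‖h‖ = ‖(x + h - x₀) - (x - x₀)‖ := by congr 1; abel
          _ ≤ ‖x + h - x₀‖ + ‖x - x₀‖ := norm_sub_le _ _
          _ < δ / 3 + δ / 3 := add_lt_add h3 h4
          _ = 2 * δ / 3 := by ring
      simp only [h0, mul_zero, integral_zero, norm_zero]
      -- The integral is zero here, so only the sign of `C₁` matters. Any member of the family
      -- forces `C₁ ≥ 0`, and a small multiple of `h` is one.
      have : 0 ≤ C₁ ∨ IsEmpty P := by
        by_cases hP : Nonempty P
        · obtain ⟨p⟩ := hP
          left
          simpa using (norm_nonneg _).trans (hC₁ p 1 one_ne_zero)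
        · exact Or.inr (not_nonempty_iff.1 hP)
      rcases this with h5 | h5
      · positivity
      · exfalso
        have hhp : 0 < ‖h‖ := norm_pos_iff.2 hh
        refine h5.false ⟨(δ / 3 * ‖h‖⁻¹) • h, smul_ne_zero (by positivity) hh, ?_⟩
        rw [norm_smul, norm_mul, norm_inv, norm_norm, mul_assoc, inv_mul_cancel₀ hhn, mul_one,
          Real.norm_of_nonneg (by positivity)]
        linarith

/-- Squaring removes `L` from the moduli, so `C` does not depend on it. The substitution `v ↦ t v`
then produces `|t|^(-D)`, and the square root halves the exponent. -/
theorem stationary_decay {u : E → ℝ} (hu : ContDiff ℝ ∞ u) (huc : HasCompactSupport u)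
    {x₀ : E} (hH : ∀ h, fderiv ℝ (fderiv ℝ u) x₀ h = 0 → h = 0) :
    ∃ W, IsOpen W ∧ x₀ ∈ W ∧ ∀ a : E → ℂ, ContDiff ℝ ∞ a → HasCompactSupport a →
      tsupport a ⊆ W → ∃ C : ℝ, ∀ (t : ℝ), t ≠ 0 → ∀ L : E →L[ℝ] ℝ,
        ‖∫ x, Complex.exp (Complex.I * (t * u x - L x : ℝ)) * a x ∂μ‖ ≤
          C * |t| ^ (-((Module.finrank ℝ E : ℝ) / 2)) := by
  obtain ⟨W, hW, hxW, h⟩ := correlation_decay μ hu huc hH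
  refine ⟨W, hW, hxW, fun a sa ca ta => ?_⟩
  set D := Module.finrank ℝ E with hD
  -- `D + 1` is the least integer power for which `(1 + ‖v‖)^(-N)` is integrable in dimension `D`.
  obtain ⟨C, hC0, hC⟩ := h a sa ca ta (D + 1)
  set S := ∫ v : E, (1 + ‖v‖) ^ (-((D + 1 : ℕ) : ℝ)) ∂μ with hS
  have hS0 : 0 ≤ S := integral_nonneg fun v => by positivity
  have hI : Integrable (fun v : E => (1 + ‖v‖) ^ (-((D + 1 : ℕ) : ℝ))) μ :=
    integrable_one_add_norm (by push_cast; linarith)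
  refine ⟨Real.sqrt (C * S), fun t ht L => ?_⟩
  have ht' : 0 < |t| := abs_pos.2 ht
  set F : E → ℂ := fun x => Complex.exp (Complex.I * (t * u x - L x : ℝ)) * a x with hF
  have cF : Continuous F := by
    have := hu.continuous
    have := sa.continuous
    have := L.continuous
    fun_prop
  have key := norm_integral_sq_le μ (cF.integrable_of_hasCompactSupport ca.mul_left)
    (b := fun v => C * (1 + ‖t • v‖) ^ (-((D + 1 : ℕ) : ℝ))) ((hI.comp_smul ht).const_mul C) (by
      intro v
      have h1 : ∀ x, F (x + v) * (starRingEnd ℂ) (F x) = Complex.exp (Complex.I * (-L v : ℝ)) *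
          (Complex.exp (Complex.I * (t * (u (x + v) - u x) : ℝ)) *
            (a (x + v) * (starRingEnd ℂ) (a x))) := by
        intro x
        simp only [hF, map_mul, ← Complex.exp_conj, Complex.conj_I, Complex.conj_ofReal, map_add]
        have : Complex.exp (Complex.I * (t * u (x + v) - (L x + L v) : ℝ)) *
            Complex.exp (-Complex.I * (t * u x - L x : ℝ)) =
            Complex.exp (Complex.I * (-L v : ℝ)) *
            Complex.exp (Complex.I * (t * (u (x + v) - u x) : ℝ)) := by
          rw [← Complex.exp_add, ← Complex.exp_add]
          congr 1
          push_cast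
          ring
        linear_combination (a (x + v) * (starRingEnd ℂ) (a x)) * this
      simp only [h1]
      rw [integral_const_mul, norm_mul, norm_exp_I_mul_ofReal, one_mul,
        Real.rpow_neg (by positivity), Real.rpow_natCast]
      exact hC t v)
  rw [integral_const_mul, Measure.integral_comp_smul μ
    (fun v : E => (1 + ‖v‖) ^ (-((D + 1 : ℕ) : ℝ)))] at key
  refine (pow_le_pow_iff_left₀ (norm_nonneg _) (by positivity) two_ne_zero).1 (key.trans_eq ?_)
  rw [mul_pow, Real.sq_sqrt (by positivity), ← Real.rpow_mul_natCast (abs_nonneg t), ← hD, abs_inv,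
    abs_pow, smul_eq_mul]
  have : -((D : ℝ) / 2) * ((2 : ℕ) : ℝ) = -(D : ℝ) := by push_cast; ring
  rw [this, Real.rpow_neg (abs_nonneg t), Real.rpow_natCast]
  ring

/-- The phase is divided by `‖L‖`. Along a direction with `|L w| ≥ ‖L‖/2`, the choice `γ = 4(M + 1)`
makes `t du` cost at most `‖L‖/4`, where `M` bounds the gradient of `u`. -/
theorem fast_decay {u : E → ℝ} (hu : ContDiff ℝ ∞ u) (huc : HasCompactSupport u) :
    ∃ γ > 0, ∀ a : E → ℂ, ContDiff ℝ ∞ a → HasCompactSupport a → ∀ N : ℕ,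
      ∃ C : ℝ, ∀ (t : ℝ) (L : E →L[ℝ] ℝ), γ * |t| ≤ ‖L‖ →
        ‖∫ x, Complex.exp (Complex.I * (t * u x - L x : ℝ)) * a x ∂μ‖ ≤
          C * ((1 + ‖L‖) ^ N)⁻¹ := by
  obtain ⟨M, hM⟩ := exists_bound_iteratedFDeriv hu huc 1
  have hM' : ∀ x, ‖fderiv ℝ u x‖ ≤ M := fun x => by
    rw [← norm_iteratedFDeriv_one]; exact hM x
  have hM0 : 0 ≤ M := (norm_nonneg _).trans (hM 0)
  refine ⟨4 * (M + 1), by positivity, fun a sa ca N => ?_⟩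
  obtain ⟨R, hR⟩ := ca.isCompact.isBounded.subset_ball (0 : E)
  set W := Metric.ball (0 : E) R
  let P := {p : ℝ × (E →L[ℝ] ℝ) // p.2 ≠ 0 ∧ 4 * (M + 1) * |p.1| ≤ ‖p.2‖}
  choose dir hdir1 hdir2 using fun L : E →L[ℝ] ℝ => exists_norm_le_one_half_le L
  let w : P → E := fun p => dir p.1.2
  have hw : ∀ p, ‖w p‖ ≤ 1 := fun p => hdir1 _
  let φ : P → E → ℂ := fun p x => ((‖p.1.2‖⁻¹ * (p.1.1 * u x - p.1.2 x) : ℝ) : ℂ)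
  have sφ0 : ∀ p : P, ContDiff ℝ ∞ (fun x => p.1.1 * u x - p.1.2 x) := fun p =>
    (contDiff_const.mul hu).sub p.1.2.contDiff
  have sφr : ∀ p : P, ContDiff ℝ ∞ (fun x => ‖p.1.2‖⁻¹ * (p.1.1 * u x - p.1.2 x)) := fun p =>
    contDiff_const.mul (sφ0 p)
  have sφ : ∀ p, ContDiff ℝ ∞ (φ p) := fun p => contDiff_ofReal_comp (sφr p)
  have hp0 : ∀ p : P, 0 < ‖p.1.2‖ := fun p => norm_pos_iff.2 p.2.1
  have hDφ : ∀ p x, dirDeriv w φ p x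
      = ((‖p.1.2‖⁻¹ * (p.1.1 * fderiv ℝ u x (w p) - p.1.2 (w p)) : ℝ) : ℂ) := by
    intro p x
    simp only [dirDeriv, φ]
    rw [fderiv_ofReal_comp ((sφr p).differentiable (by simp) x),
      fderiv_const_mul ((sφ0 p).differentiable (by simp) x),
      fderiv_fun_sub ((contDiff_const.mul hu).differentiable (by simp) x)
        p.1.2.differentiableAt,
      fderiv_const_mul (hu.differentiable (by simp) x), ContinuousLinearMap.fderiv]
    rfl
  have hφd : ∀ p, ∀ x ∈ W, (1 / 4 : ℝ) ≤ ‖dirDeriv w φ p x‖ := by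
    intro p x _
    rw [hDφ, Complex.norm_real, norm_mul, norm_inv, norm_norm, inv_mul_eq_div, le_div_iff₀ (hp0 p)]
    have h1 := norm_sub_norm_le (p.1.2 (w p)) (p.1.1 * fderiv ℝ u x (w p))
    rw [norm_sub_rev] at h1
    have h2 : ‖p.1.1 * fderiv ℝ u x (w p)‖ ≤ |p.1.1| * M := by
      rw [norm_mul, Real.norm_eq_abs]
      refine mul_le_mul_of_nonneg_left ?_ (abs_nonneg _)
      exact ((fderiv ℝ u x).le_opNorm _).trans
        ((mul_le_of_le_one_right (norm_nonneg _) (hw p)).trans (hM' x))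
    have h3 := hdir2 p.1.2
    have h4 := p.2.2
    have h5 := abs_nonneg p.1.1
    change ‖p.1.2‖ / 2 ≤ ‖p.1.2 (w p)‖ at h3
    linarith
  have hφb : ∀ k, BoundedDerivs W w k (dirDeriv w φ) := by
    intro k
    have suc := contDiff_ofReal_comp hu
    have h1 : BoundedDerivs W w (k + 1) (fun _ x => (u x : ℂ)) := by
      refine boundedDerivs_of_iteratedFDeriv hw (fun _ => suc) fun m => ?_
      obtain ⟨C, hC⟩ := exists_bound_iteratedFDeriv suc
        (huc.comp_left (g := ((↑) : ℝ → ℂ)) (by simp)) m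
      exact ⟨C, fun _ x => hC x⟩
    have h2 : ∀ p : P, ContDiff ℝ ∞ (dirDeriv w (fun _ x => (u x : ℂ)) p) :=
      contDiff_dirDeriv fun _ => suc
    have h3 : BoundedDerivs W w k (fun p _ => ((‖p.1.2‖⁻¹ * p.1.1 : ℝ) : ℂ)) := by
      refine boundedDerivs_const (C := 1) fun p => ?_
      rw [Complex.norm_real, norm_mul, norm_inv, norm_norm, inv_mul_eq_div, div_le_one (hp0 p),
        Real.norm_eq_abs]
      have h4 := p.2.2
      nlinarith [abs_nonneg p.1.1]
    have h4 : BoundedDerivs W w k (fun p _ => ((-(‖p.1.2‖⁻¹ * p.1.2 (w p)) : ℝ) : ℂ)) := by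
      refine boundedDerivs_const (C := 1) fun p => ?_
      rw [Complex.norm_real, norm_neg, norm_mul, norm_inv, norm_norm, inv_mul_eq_div,
        div_le_one (hp0 p)]
      exact (p.1.2.le_opNorm _).trans (mul_le_of_le_one_right (norm_nonneg _) (hw p))
    refine (BoundedDerivs.add Metric.isOpen_ball (fun p => contDiffOn_const.mul (h2 p).contDiffOn)
      (fun p => contDiffOn_const) (BoundedDerivs.mul
        (f := fun p _ => ((‖p.1.2‖⁻¹ * p.1.1 : ℝ) : ℂ)) Metric.isOpen_ball (fun p => contDiffOn_const)
        (fun p => (h2 p).contDiffOn) h3 h1.2) h4).congr Metric.isOpen_ball fun p x _ => ?_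
    rw [hDφ]
    simp only [dirDeriv]
    rw [fderiv_ofReal_comp (hu.differentiable (by simp) x)]
    push_cast
    ring
  obtain ⟨C₁, hC₁⟩ := nonstationary_phase μ (W := W) Metric.isOpen_ball measure_ball_lt_top.ne sφ
    (fun p x => Complex.ofReal_im _) (by norm_num) hφd hφb N (fun _ => a) (fun _ => sa)
    (fun _ => ca) (fun _ => hR) (fun k => by
      refine boundedDerivs_of_iteratedFDeriv hw (fun _ => sa) fun m => ?_
      obtain ⟨C, hC⟩ := exists_bound_iteratedFDeriv sa ca m
      exact ⟨C, fun _ x => hC x⟩)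
  refine ⟨2 ^ N * (2 * (∫ x, ‖a x‖ ∂μ) + |C₁|), fun t L hL => ?_⟩
  refine le_mul_inv_one_add_pow (B := C₁) (norm_nonneg _) (norm_nonneg _) ?_ ?_
  · refine (norm_integral_le_integral_norm _).trans_eq ?_
    congr 1
    ext x
    rw [norm_mul, norm_exp_I_mul_ofReal, one_mul]
  · intro hL0
    have h1 := hC₁ ⟨(t, L), norm_ne_zero_iff.1 hL0, hL⟩ ‖L‖ hL0
    rw [abs_norm] at h1
    refine le_trans (le_of_eq ?_) h1
    congr 2
    ext x
    simp only [φ]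
    congr 2
    rw [mul_assoc, ← Complex.ofReal_mul]
    congr 2
    field_simp

end Decay

end OscillatoryIntegral

/-! ### Integration over the torus. -/

namespace HarmonicCrystal

variable {d : ℕ}

/-- The cell of the torus centred at `s`. -/
def shiftedCell (s : Fin d → ℝ) : Set (Fin d → ℝ) :=
  Set.univ.pi fun i => Set.Ioc (s i - Real.pi) (s i + Real.pi)

theorem existsUnique_mem_shiftedCell (s θ : Fin d → ℝ) :
    ∃! m : Fin d → ℤ, (fun i => θ i + 2 * Real.pi * (m i : ℝ)) ∈ shiftedCell s := by
  have h : ∀ i, ∃! m : ℤ, θ i + 2 * Real.pi * (m : ℝ) ∈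
      Set.Ioc (s i - Real.pi) (s i + Real.pi) := by
    intro i
    have := existsUnique_add_zsmul_mem_Ioc Real.two_pi_pos (θ i) (s i - Real.pi)
    have h2 : s i - Real.pi + 2 * Real.pi = s i + Real.pi := by ring
    rw [h2] at this
    simpa only [zsmul_eq_mul, mul_comm] using this
  choose m hm hu using h
  exact ⟨m, fun i _ => hm i, fun m' hm' => funext fun i => hu i _ (hm' i trivial)⟩

/-- The lattice `2πℤ^d`. -/
noncomputable def periodLattice (d : ℕ) : AddSubgroup (Fin d → ℝ) :=
  AddMonoidHom.range
    { toFun := fun (m : Fin d → ℤ) i => 2 * Real.pi * (m i : ℝ)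
      map_zero' := by ext; simp
      map_add' := fun a b => by ext; simp [mul_add] }

instance : Countable (periodLattice d) := by
  unfold periodLattice
  exact (Set.countable_range _).to_subtype

theorem measurableSet_shiftedCell (s : Fin d → ℝ) : MeasurableSet (shiftedCell s) :=
  MeasurableSet.univ_pi fun _ => measurableSet_Ioc

theorem isAddFundamentalDomain_shiftedCell (s : Fin d → ℝ) :
    IsAddFundamentalDomain (periodLattice d) (shiftedCell s) := by
  refine IsAddFundamentalDomain.mk' (measurableSet_shiftedCell s).nullMeasurableSet fun θ => ?_
  obtain ⟨m, hm, hu⟩ := existsUnique_mem_shiftedCell s θ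
  refine ⟨⟨_, m, rfl⟩, ?_, ?_⟩
  · convert hm using 1
    ext i
    exact add_comm _ _
  · rintro ⟨_, m', rfl⟩ h
    have : m' = m := by
      apply hu
      convert h using 1
      ext i
      exact add_comm _ _
    subst this
    rfl

theorem cell_eq_shiftedCell : cell d = shiftedCell 0 := by
  simp [cell, shiftedCell]

/-- The cell and its translate are both fundamental domains of the period lattice. -/
theorem setIntegral_cell_add {F : (Fin d → ℝ) → ℂ} (hF : TorusPeriodic F) (s : Fin d → ℝ) :
    ∫ θ in cell d, F (θ + s) = ∫ θ in cell d, F θ := by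
  have h1 : ∫ θ in cell d, F (θ + s) = ∫ θ in shiftedCell s, F θ := by
    rw [cell_eq_shiftedCell, ← integral_indicator (measurableSet_shiftedCell s),
      ← integral_indicator (measurableSet_shiftedCell 0),
      ← integral_add_right_eq_self ((shiftedCell s).indicator F) s]
    congr 1
    ext θ
    simp only [Set.indicator, shiftedCell, Set.mem_univ_pi, Set.mem_Ioc, Pi.add_apply, Pi.zero_apply]
    congr 1
    refine propext (forall_congr' fun i => and_congr ?_ ?_) <;> constructor <;> intro h <;> linarith
  rw [h1, cell_eq_shiftedCell]
  refine (isAddFundamentalDomain_shiftedCell s).setIntegral_eq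
    (isAddFundamentalDomain_shiftedCell 0) ?_
  rintro ⟨_, m, rfl⟩ θ
  rw [← hF θ m]
  congr 1
  ext i
  exact add_comm _ _

theorem TorusPeriodic.exists_bound {F : (Fin d → ℝ) → ℂ} (hF : TorusPeriodic F)
    (hc : Continuous F) : ∃ C : ℝ, ∀ θ, ‖F θ‖ ≤ C := by
  have hK : IsCompact (Set.univ.pi fun _ : Fin d => Set.Icc ((0:ℝ) - Real.pi) (0 + Real.pi)) :=
    isCompact_univ_pi fun _ => isCompact_Icc
  obtain ⟨C, hC⟩ := hK.exists_bound_of_continuousOn hc.continuousOn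
  refine ⟨C, fun θ => ?_⟩
  obtain ⟨m, hm, -⟩ := existsUnique_mem_shiftedCell 0 θ
  rw [← hF θ m]
  exact hC _ fun i hi => Set.Ioc_subset_Icc_self (hm i hi)

theorem isBounded_cell : Bornology.IsBounded (cell d) :=
  (isCompact_univ_pi fun _ : Fin d => isCompact_Icc (a := -Real.pi) (b := Real.pi)).isBounded.subset
    (Set.pi_mono fun _ _ => Set.Ioc_subset_Icc_self)

/-- Integrals over the torus as integrals over `ℝ^d` against a smooth compactly supported weight. -/
theorem exists_unfolding_weight (d : ℕ) :
    ∃ ρ : (Fin d → ℝ) → ℂ, ContDiff ℝ ∞ ρ ∧ HasCompactSupport ρ ∧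
      ∀ F : (Fin d → ℝ) → ℂ, Continuous F → TorusPeriodic F →
        ∫ θ in cell d, F θ = ∫ θ, ρ θ * F θ := by
  have hmeas : MeasurableSet (cell d) := by
    rw [cell_eq_shiftedCell]; exact measurableSet_shiftedCell 0
  let bump : ContDiffBump (0 : Fin d → ℝ) := default
  let κ : (Fin d → ℝ) → ℝ := bump.normed volume
  have sκ : ContDiff ℝ ∞ κ := bump.contDiff_normed
  have cκ : HasCompactSupport κ := bump.hasCompactSupport_normed
  let χ : (Fin d → ℝ) → ℝ := (cell d).indicator fun _ => 1
  have cχ : HasCompactSupport χ :=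
    HasCompactSupport.intro (isBounded_cell (d := d)).isCompact_closure fun x hx =>
      Set.indicator_of_notMem (fun h => hx (subset_closure h)) _
  have iχ : Integrable χ :=
    (integrable_indicator_iff hmeas).2
      (integrableOn_const (hs := isBounded_cell.measure_lt_top.ne) (hC := by simp))
  let L := ContinuousLinearMap.mul ℝ ℝ
  have sρ := cκ.contDiff_convolution_left L sκ iχ.locallyIntegrable (μ := volume)
  have cρ : HasCompactSupport (convolution κ χ L volume) := cκ.convolution L cχ
  refine ⟨fun θ => ((convolution κ χ L volume θ : ℝ) : ℂ),
    OscillatoryIntegral.contDiff_ofReal_comp sρ, cρ.comp_left (g := ((↑) : ℝ → ℂ)) (by simp),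
    fun F cF pF => ?_⟩
  obtain ⟨C, hC⟩ := pF.exists_bound cF
  have iκ : Integrable κ := sκ.continuous.integrable_of_hasCompactSupport cκ
  have hint : Integrable (fun z : (Fin d → ℝ) × (Fin d → ℝ) =>
      ((κ z.1 * χ (z.2 - z.1) : ℝ) : ℂ) * F z.2) (volume.prod volume) := by
    have h1 : Integrable (fun z : (Fin d → ℝ) × (Fin d → ℝ) =>
        F (z.1 + z.2) * ((κ z.1 * χ z.2 : ℝ) : ℂ)) (volume.prod volume) :=
      (iκ.mul_prod iχ).ofReal.bdd_mul (c := C)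
        (cF.comp (continuous_fst.add continuous_snd)).aestronglyMeasurable
        (Filter.Eventually.of_forall fun z => hC _)
    have h2 := (measurePreserving_prod_neg_add volume volume).integrable_comp_of_integrable h1
    refine h2.congr (Filter.Eventually.of_forall fun z => ?_)
    simp only [Function.comp_apply, add_neg_cancel_left]
    rw [mul_comm, neg_add_eq_sub]
  -- Averaging the translation invariance against the mollifier `κ` replaces the sharp indicator of
  -- the cell by its smooth convolution with `κ`; integration by parts then has no boundary terms.
  calc ∫ θ in cell d, F θ = ∫ s, (κ s : ℂ) * ∫ θ in cell d, F (θ + s) := by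
        simp only [setIntegral_cell_add pF]
        rw [integral_mul_const, integral_complex_ofReal, bump.integral_normed]
        simp
    _ = ∫ s, ∫ θ, ((κ s * χ (θ - s) : ℝ) : ℂ) * F θ := by
        congr 1
        ext s
        rw [← integral_indicator hmeas, ← integral_const_mul,
          ← integral_sub_right_eq_self _ s]
        congr 1
        ext θ
        by_cases h : θ - s ∈ cell d <;> simp [χ, h]
    _ = ∫ θ, ∫ s, ((κ s * χ (θ - s) : ℝ) : ℂ) * F θ := integral_integral_swap hint
    _ = _ := by
        congr 1
        ext θ
        rw [integral_mul_const, integral_complex_ofReal]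
        rfl

end HarmonicCrystal

namespace OscillatoryIntegral

/-- Makes a local dispersion relation a global phase with the same germ, hence the same Hessian at
`x₀`. -/
theorem exists_contDiff_eventuallyEq {E : Type*} [NormedAddCommGroup E] [NormedSpace ℝ E]
    [FiniteDimensional ℝ E] {f : E → ℝ} {x₀ : E}
    {U : Set E} (hU : IsOpen U) (hf : ContDiffOn ℝ ∞ f U) (hx : x₀ ∈ U) :
    ∃ u : E → ℝ, ContDiff ℝ ∞ u ∧ HasCompactSupport u ∧ u =ᶠ[nhds x₀] f := by
  obtain ⟨R, hR, hRU⟩ := Metric.nhds_basis_closedBall.mem_iff.1 (hU.mem_nhds hx)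
  let χ : ContDiffBump x₀ := ⟨R / 2, R, half_pos hR, half_lt_self hR⟩
  refine ⟨fun x => χ x * f x, contDiff_mul_of_tsupport_subset hU χ.contDiff hf
    (by rw [χ.tsupport_eq]; exact hRU), χ.hasCompactSupport.mul_right, ?_⟩
  filter_upwards [χ.eventuallyEq_one] with x hx
  simp [hx]

end OscillatoryIntegral

namespace HarmonicCrystal

variable {d n : ℕ}

theorem fderiv_fderiv_injective_of_hessianDet_ne_zero {f : (Fin d → ℝ) → ℝ} {θ : Fin d → ℝ}
    (hf : hessianDet f θ ≠ 0) (h : Fin d → ℝ) (hh : fderiv ℝ (fderiv ℝ f) θ h = 0) : h = 0 := by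
  refine Matrix.eq_zero_of_vecMul_eq_zero hf (funext fun j => ?_)
  have h1 : fderiv ℝ (fderiv ℝ f) θ h (Pi.single j 1) = 0 := by rw [hh]; rfl
  rw [pi_eq_sum_univ' h, map_sum] at h1
  simp only [map_smul, sum_apply, FunLike.coe_smul, Pi.smul_apply,
    smul_eq_mul] at h1
  simp only [Matrix.vecMul, dotProduct, Matrix.of_apply, iteratedFDeriv_two_apply, Pi.zero_apply]
  refine Eq.trans ?_ h1
  refine Finset.sum_congr rfl fun i _ => ?_
  simp

/-! ### Spectral decomposition of the generator. -/

section BlockDiagonalization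

variable {B M : Matrix (Fin n) (Fin n) ℂ} {w : Fin n → ℝ}

/-- The eigenvectors of the generator, for `V̂ = B diag(w)² Bᴴ`. -/
noncomputable def eigenvectors (B : Matrix (Fin n) (Fin n) ℂ) (w : Fin n → ℝ) :
    Matrix (Fin n ⊕ Fin n) (Fin n ⊕ Fin n) ℂ :=
  Matrix.fromBlocks (B * Matrix.diagonal fun k => Complex.I * w k)
    (-(B * Matrix.diagonal fun k => Complex.I * w k)) B B

/-- The inverse of the matrix of eigenvectors of the generator. -/
noncomputable def eigenvectorsInv (B : Matrix (Fin n) (Fin n) ℂ) (w : Fin n → ℝ) :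
    Matrix (Fin n ⊕ Fin n) (Fin n ⊕ Fin n) ℂ :=
  (2⁻¹ : ℂ) • Matrix.fromBlocks ((Matrix.diagonal fun k => (Complex.I * w k)⁻¹) * Bᴴ) Bᴴ
    (-((Matrix.diagonal fun k => (Complex.I * w k)⁻¹) * Bᴴ)) Bᴴ

/-- The branches `±w` of the dispersion relation. -/
def signedBranch {X : Type*} (w : Fin n → X → ℝ) : Fin n ⊕ Fin n → X → ℝ :=
  Sum.elim w fun k θ => -w k θ

theorem eigenvectors_mul_inv (hB : B ∈ Matrix.unitaryGroup (Fin n) ℂ) (hw : ∀ k, w k ≠ 0) :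
    eigenvectors B w * eigenvectorsInv B w = 1 := by
  have hBB : B * Bᴴ = 1 := Matrix.mem_unitaryGroup_iff.1 hB
  have h1 : (B * Matrix.diagonal fun k => Complex.I * (w k : ℂ)) *
      ((Matrix.diagonal fun k => (Complex.I * (w k : ℂ))⁻¹) * Bᴴ) = 1 := by
    rw [← mul_assoc, mul_assoc B, Matrix.diagonal_mul_diagonal]
    have : (fun k => Complex.I * (w k : ℂ) * (Complex.I * (w k : ℂ))⁻¹) = fun _ => 1 := by
      ext k
      exact mul_inv_cancel₀ (mul_ne_zero Complex.I_ne_zero (by exact_mod_cast hw k))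
    rw [this, Matrix.diagonal_one, mul_one, hBB]
  rw [eigenvectors, eigenvectorsInv, Matrix.mul_smul, Matrix.fromBlocks_multiply]
  simp only [Matrix.neg_mul, Matrix.mul_neg, neg_neg, h1, hBB, add_neg_cancel]
  rw [← two_smul ℂ (1 : Matrix (Fin n) (Fin n) ℂ), Matrix.fromBlocks_smul, smul_smul]
  simp

/-- The columns `(±i w_k B e_k, B e_k)` are eigenvectors because `M B = -B diag(i w)²`; they form a
basis because no `w_k` vanishes. -/
theorem generator_eq (hB : B ∈ Matrix.unitaryGroup (Fin n) ℂ) (hw : ∀ k, w k ≠ 0)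
    (hM : M = (B * Matrix.diagonal (fun k => (w k : ℂ)) * Bᴴ) *
      (B * Matrix.diagonal (fun k => (w k : ℂ)) * Bᴴ)) :
    Matrix.fromBlocks 0 (-M) 1 0 = eigenvectors B w *
      Matrix.diagonal (Sum.elim (fun k => Complex.I * (w k : ℂ)) fun k => -(Complex.I * (w k : ℂ))) *
      eigenvectorsInv B w := by
  have hBB : Bᴴ * B = 1 := Matrix.mem_unitaryGroup_iff'.1 hB
  have hMB : M * B = -(B * (Matrix.diagonal (fun k => Complex.I * (w k : ℂ)) *
      Matrix.diagonal (fun k => Complex.I * (w k : ℂ)))) := by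
    have h2 : Matrix.diagonal (fun k => Complex.I * (w k : ℂ)) =
        Complex.I • Matrix.diagonal (fun k => (w k : ℂ)) := by
      rw [← Matrix.diagonal_smul]; rfl
    rw [hM, h2]
    simp only [Matrix.smul_mul, Matrix.mul_smul, smul_smul, Complex.I_mul_I, neg_smul, one_smul,
      mul_neg, neg_neg, mul_assoc, hBB, mul_one]
    rw [← mul_assoc Bᴴ B, hBB, one_mul]
  have h3 : Matrix.fromBlocks 0 (-M) 1 0 * eigenvectors B w = eigenvectors B w *
      Matrix.diagonal
        (Sum.elim (fun k => Complex.I * (w k : ℂ)) fun k => -(Complex.I * (w k : ℂ))) := by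
    have h4 : Matrix.diagonal (fun k => -(Complex.I * (w k : ℂ))) =
        -Matrix.diagonal (fun k => Complex.I * (w k : ℂ)) := by
      rw [← Matrix.diagonal_neg]
    rw [← Matrix.fromBlocks_diagonal, eigenvectors, Matrix.fromBlocks_multiply,
      Matrix.fromBlocks_multiply, h4]
    generalize Matrix.diagonal (fun k => Complex.I * (w k : ℂ)) = D at hMB ⊢
    simp [hMB, mul_assoc]
  rw [← h3, mul_assoc, eigenvectors_mul_inv hB hw, mul_one]

theorem exp_generator_mulVec (hB : B ∈ Matrix.unitaryGroup (Fin n) ℂ) (hw : ∀ k, w k ≠ 0)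
    (hM : M = (B * Matrix.diagonal (fun k => (w k : ℂ)) * Bᴴ) *
      (B * Matrix.diagonal (fun k => (w k : ℂ)) * Bᴴ)) (t : ℝ) (v : Fin n ⊕ Fin n → ℂ)
    (c : Fin n ⊕ Fin n) :
    (NormedSpace.exp ((t : ℂ) • Matrix.fromBlocks 0 (-M) 1 0) *ᵥ v) c =
      ∑ j, Complex.exp (Complex.I * (t * Sum.elim w (fun k => -w k) j : ℝ)) *
        (eigenvectors B w c j * ∑ l, eigenvectorsInv B w j l * v l) := by
  have h1 := eigenvectors_mul_inv hB hw
  have hinv := Matrix.inv_eq_right_inv h1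
  have hu : IsUnit (eigenvectors B w) := (Matrix.isUnit_iff_isUnit_det _).2
    (Matrix.isUnit_det_of_right_inverse h1)
  rw [generator_eq hB hw hM, ← hinv, ← Matrix.smul_mul, ← Matrix.mul_smul, ← Matrix.diagonal_smul,
    Matrix.exp_conj _ _ hu, Matrix.exp_diagonal, hinv, ← Matrix.mulVec_mulVec,
    ← Matrix.mulVec_mulVec]
  simp only [Matrix.mulVec, dotProduct, Matrix.diagonal_apply, ite_mul, zero_mul,
    Finset.sum_ite_eq, Finset.mem_univ, if_true]
  refine Finset.sum_congr rfl fun j _ => ?_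
  have h2 : NormedSpace.exp ((t : ℂ) • Sum.elim (fun k => Complex.I * (w k : ℂ))
      fun k => -(Complex.I * (w k : ℂ))) j =
      Complex.exp (Complex.I * (t * Sum.elim w (fun k => -w k) j : ℝ)) := by
    rw [Pi.coe_exp, Complex.exp_eq_exp_ℂ]
    congr 1
    rcases j with k | k <;> simp <;> ring
  rw [h2]
  ring

end BlockDiagonalization

/-! ### Smoothness of the amplitudes. -/

theorem contDiff_character (z : Fin d → ℤ) : ContDiff ℝ ∞ (character z) := by
  unfold character pairing
  refine ContDiff.cexp (contDiff_const.mul (OscillatoryIntegral.contDiff_ofReal_comp ?_))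
  fun_prop

theorem contDiff_Psihat (Ψ : TestSpace d n) (l : Fin n ⊕ Fin n) :
    ContDiff ℝ ∞ (fun θ => Psihat Ψ θ l) := by
  have h : ∀ (ψ : (Fin d → ℤ) →₀ (Fin n → ℝ)) k, ContDiff ℝ ∞ (fun θ => fourierComponent ψ θ k) :=
    fun ψ k => ContDiff.sum fun z _ => contDiff_const.mul (contDiff_character z)
  rcases l with k | k
  · exact h Ψ.1 k
  · exact h Ψ.2 k

section Smoothness

variable {B : (Fin d → ℝ) → Matrix (Fin n) (Fin n) ℂ} {w : Fin n → (Fin d → ℝ) → ℝ}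
  {U : Set (Fin d → ℝ)}

theorem contDiffOn_eigenvectors (hw : ∀ k, ContDiffOn ℝ ∞ (w k) U)
    (hB : ∀ k l, ContDiffOn ℝ ∞ (fun θ => B θ k l) U) (c j : Fin n ⊕ Fin n) :
    ContDiffOn ℝ ∞ (fun θ => eigenvectors (B θ) (fun k => w k θ) c j) U := by
  have hwc : ∀ k, ContDiffOn ℝ ∞ (fun θ => Complex.I * (w k θ : ℂ)) U := fun k =>
    contDiffOn_const.mul (Complex.ofRealCLM.contDiff.comp_contDiffOn (hw k))
  rcases c with c | c <;> rcases j with j | j <;>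
    simp only [eigenvectors, Matrix.fromBlocks_apply₁₁, Matrix.fromBlocks_apply₁₂,
      Matrix.fromBlocks_apply₂₁, Matrix.fromBlocks_apply₂₂, Matrix.neg_apply,
      Matrix.mul_diagonal]
  · exact (hB c j).mul (hwc j)
  · exact ((hB c j).mul (hwc j)).neg
  · exact hB c j
  · exact hB c j

theorem contDiffOn_eigenvectorsInv (hw : ∀ k, ContDiffOn ℝ ∞ (w k) U)
    (hw0 : ∀ θ ∈ U, ∀ k, w k θ ≠ 0)
    (hB : ∀ k l, ContDiffOn ℝ ∞ (fun θ => B θ k l) U) (c j : Fin n ⊕ Fin n) :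
    ContDiffOn ℝ ∞ (fun θ => eigenvectorsInv (B θ) (fun k => w k θ) c j) U := by
  have hwc : ∀ k, ContDiffOn ℝ ∞ (fun θ => (Complex.I * (w k θ : ℂ))⁻¹) U := fun k =>
    (contDiffOn_const.mul (Complex.ofRealCLM.contDiff.comp_contDiffOn (hw k))).inv fun θ hθ =>
      mul_ne_zero Complex.I_ne_zero (Complex.ofReal_ne_zero.2 (hw0 θ hθ k))
  have hBc : ∀ k l, ContDiffOn ℝ ∞ (fun θ => star (B θ k l)) U := fun k l =>
    Complex.conjCLE.contDiff.comp_contDiffOn (hB k l)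
  rcases c with c | c <;> rcases j with j | j <;>
    simp only [eigenvectorsInv, Matrix.smul_apply, Matrix.fromBlocks_apply₁₁,
      Matrix.fromBlocks_apply₁₂, Matrix.fromBlocks_apply₂₁, Matrix.fromBlocks_apply₂₂,
      Matrix.neg_apply, Matrix.diagonal_mul, Matrix.conjTranspose_apply, smul_eq_mul]
  · exact contDiffOn_const.mul ((hwc c).mul (hBc j c))
  · exact contDiffOn_const.mul (hBc j c)
  · exact contDiffOn_const.mul ((hwc c).mul (hBc j c)).neg
  · exact contDiffOn_const.mul (hBc j c)

end Smoothness

/-! ### The local form of the dynamics off the critical set. -/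

theorem Vhat_eq_sq {V : (Fin d → ℤ) → Matrix (Fin n) (Fin n) ℝ} (hV : NonnegativeInteraction V)
    (θ : Fin d → ℝ) : Vhat V θ = Omega V θ * Omega V θ :=
  (CFC.sqrt_mul_sqrt_self _ (hV θ).nonneg).symm

/-- Collects all that is needed from the definition of the critical set. The order of quantifiers
matters: `W`, `γ` and the phases precede `Ψ`, which enters only through the amplitudes `b`. -/
theorem exists_local_representation {V : (Fin d → ℤ) → Matrix (Fin n) (Fin n) ℝ}
    (hV : NonnegativeInteraction V) {θ₀ : Fin d → ℝ} (hθ₀ : θ₀ ∉ criticalSet V) :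
    ∃ W : Set (Fin d → ℝ), IsOpen W ∧ θ₀ ∈ W ∧ ∃ γ > 0, ∃ u : Fin n ⊕ Fin n → (Fin d → ℝ) → ℝ,
      (∀ j, ContDiff ℝ ∞ (u j)) ∧
      (∀ j, ∀ a : (Fin d → ℝ) → ℂ, ContDiff ℝ ∞ a → HasCompactSupport a → tsupport a ⊆ W →
        (∃ C : ℝ, ∀ t : ℝ, t ≠ 0 → ∀ L : (Fin d → ℝ) →L[ℝ] ℝ,
          ‖∫ x, Complex.exp (Complex.I * (t * u j x - L x : ℝ)) * a x‖ ≤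
            C * |t| ^ (-((d : ℝ) / 2))) ∧
        ∀ N : ℕ, ∃ C : ℝ, ∀ (t : ℝ) (L : (Fin d → ℝ) →L[ℝ] ℝ), γ * |t| ≤ ‖L‖ →
          ‖∫ x, Complex.exp (Complex.I * (t * u j x - L x : ℝ)) * a x‖ ≤
            C * ((1 + ‖L‖) ^ N)⁻¹) ∧
      ∀ (Ψ : TestSpace d n) (c : Fin n ⊕ Fin n), ∃ b : Fin n ⊕ Fin n → (Fin d → ℝ) → ℂ,
        (∀ j, ContDiffOn ℝ ∞ (b j) W) ∧ ∀ θ ∈ W, ∀ t : ℝ,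
          (dualGreen V t θ *ᵥ Psihat Ψ θ) c =
            ∑ j, Complex.exp (Complex.I * (t * u j θ : ℝ)) * b j θ := by
  simp only [criticalSet, Set.mem_union, not_or] at hθ₀
  obtain ⟨⟨hdeg, hcross⟩, hzero⟩ := hθ₀
  obtain ⟨U, hU, hθU, w, B, hwB⟩ := not_not.1 hcross
  have hhess : ∀ k, hessianDet (w k) θ₀ ≠ 0 := fun k hk =>
    hdeg ⟨hcross, U, hU, hθU, w, B, hwB, k, hk⟩
  -- `det V̂` is the product of the `w_k²`, up to the unimodular determinants of `B` and `Bᴴ`.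
  have hw0 : ∀ k, w k θ₀ ≠ 0 := by
    intro k hk
    apply hzero
    change (Vhat V θ₀).det = 0
    rw [Vhat_eq_sq hV, hwB.diagonalizes θ₀ hθU]
    simp only [Matrix.det_mul, Matrix.det_diagonal]
    rw [Finset.prod_eq_zero (Finset.mem_univ k) (by simp [hk])]
    simp
  have sw : ∀ k, ContDiffOn ℝ ∞ (w k) U := fun k => (hwB.analytic_eigenvalue k).contDiffOn hU.uniqueDiffOn
  have sB : ∀ k l, ContDiffOn ℝ ∞ (fun θ => B θ k l) U := fun k l =>
    (hwB.analytic_basis k l).contDiffOn hU.uniqueDiffOn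
  choose v sv cv hv using fun k => OscillatoryIntegral.exists_contDiff_eventuallyEq hU (sw k) hθU
  have su : ∀ j, ContDiff ℝ ∞ (signedBranch v j) := by
    rintro (k | k)
    · exact sv k
    · exact (sv k).neg
  have cu : ∀ j, HasCompactSupport (signedBranch v j) := by
    rintro (k | k)
    · exact cv k
    · exact (cv k).comp_left (g := fun y : ℝ => -y) neg_zero
  have hHv : ∀ k h, fderiv ℝ (fderiv ℝ (v k)) θ₀ h = 0 → h = 0 := by
    intro k h hh
    rw [(hv k).fderiv.fderiv_eq] at hh
    exact fderiv_fderiv_injective_of_hessianDet_ne_zero (hhess k) h hh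
  have hHu : ∀ j h, fderiv ℝ (fderiv ℝ (signedBranch v j)) θ₀ h = 0 → h = 0 := by
    rintro (k | k) h hh
    · exact hHv k h hh
    · apply hHv k h
      have h1 : fderiv ℝ (signedBranch v (Sum.inr k)) = fun θ => -fderiv ℝ (v k) θ := by
        ext1 θ
        exact fderiv_neg
      rw [h1, fderiv_fun_neg] at hh
      simpa using hh
  choose W' hW' hθW' hstat using fun j =>
    OscillatoryIntegral.stationary_decay volume (su j) (cu j) (hHu j)
  choose γ hγ hfast using fun j => OscillatoryIntegral.fast_decay volume (su j) (cu j)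
  have hev : ∀ᶠ θ in nhds θ₀, θ ∈ U ∧ (∀ k, w k θ ≠ 0) ∧ (∀ k, v k θ = w k θ) ∧
      ∀ j, θ ∈ W' j := by
    refine Filter.Eventually.and (hU.mem_nhds hθU) (.and ?_ (.and (Filter.eventually_all.2 hv) ?_))
    · refine Filter.eventually_all.2 fun k => ?_
      exact ((sw k).continuousOn.continuousAt (hU.mem_nhds hθU)).eventually_ne (hw0 k)
    · exact Filter.eventually_all.2 fun j => (hW' j).mem_nhds (hθW' j)
  obtain ⟨W, hWsub, hW, hθW⟩ := eventually_nhds_iff.1 hev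
  refine ⟨W, hW, hθW, 1 + ∑ j, γ j,
    add_pos_of_pos_of_nonneg one_pos (Finset.sum_nonneg fun j _ => (hγ j).le),
    signedBranch v, su, fun j a sa ca ta => ⟨?_, fun N => ?_⟩, fun Ψ c => ?_⟩
  · have := hstat j a sa ca fun x hx => (hWsub x (ta hx)).2.2.2 j
    simpa using this
  · obtain ⟨C, hC⟩ := hfast j a sa ca N
    refine ⟨C, fun t L hL => hC t L (le_trans ?_ hL)⟩
    refine mul_le_mul_of_nonneg_right ?_ (abs_nonneg t)
    have := Finset.single_le_sum (f := γ) (fun j _ => (hγ j).le) (Finset.mem_univ j)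
    linarith
  · have hWU : W ⊆ U := fun x hx => (hWsub x hx).1
    refine ⟨fun j θ => eigenvectors (B θ) (fun k => w k θ) c j *
      ∑ l, eigenvectorsInv (B θ) (fun k => w k θ) j l * Psihat Ψ θ l, fun j => ?_, fun θ hθ t => ?_⟩
    · refine ContDiffOn.mul (contDiffOn_eigenvectors (fun k => (sw k).mono hWU)
        (fun k l => (sB k l).mono hWU) c j) (ContDiffOn.sum fun l _ => ContDiffOn.mul
        (contDiffOn_eigenvectorsInv (fun k => (sw k).mono hWU) (fun θ hθ => (hWsub θ hθ).2.1)
          (fun k l => (sB k l).mono hWU) j l) (contDiff_Psihat Ψ l).contDiffOn)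
    · obtain ⟨hθU', hwθ, hvw, -⟩ := hWsub θ hθ
      have hM := Vhat_eq_sq hV θ
      rw [hwB.diagonalizes θ hθU'] at hM
      rw [dualGreen, dualGenerator, exp_generator_mulVec (hwB.unitary θ hθU') hwθ hM]
      refine Finset.sum_congr rfl fun j _ => ?_
      have : signedBranch v j θ = Sum.elim (fun k => w k θ) (fun k => -w k θ) j := by
        rcases j with k | k <;> simp [signedBranch, hvw]
      rw [this]


/-- The pairing with a lattice vector as a linear form. -/
noncomputable def pairingCLM (x : Fin d → ℤ) : (Fin d → ℝ) →L[ℝ] ℝ :=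
  ∑ i, (x i : ℝ) • ContinuousLinearMap.proj (R := ℝ) (φ := fun _ : Fin d => ℝ) i

theorem pairingCLM_apply (x : Fin d → ℤ) (θ : Fin d → ℝ) : pairingCLM x θ = pairing θ x := by
  simp [pairingCLM, pairing, mul_comm, sum_apply]

/-- The operator norm is dual to the sup norm on `ℝ^d`. Testing the form on `x` itself gives `|x|²`,
while the sup norm of `x` is at most `|x|`. -/
theorem latticeNorm_le_norm_pairingCLM (x : Fin d → ℤ) : latticeNorm x ≤ ‖pairingCLM x‖ := by
  set r := latticeNorm x with hr
  have hr0 : 0 ≤ r := norm_nonneg _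
  rcases hr0.eq_or_lt with h0 | h0
  · rw [← h0]; exact norm_nonneg _
  have hsq : ∑ i, (x i : ℝ) * (x i : ℝ) = r ^ 2 := by
    rw [hr, latticeNorm, EuclideanSpace.norm_sq_eq]
    simp [sq]
  have hx : ‖(fun i => (x i : ℝ))‖ ≤ r :=
    (pi_norm_le_iff_of_nonneg hr0).2 fun i => by
      have := PiLp.norm_apply_le (WithLp.toLp 2 fun i => (x i : ℝ)) i
      rw [hr, latticeNorm]
      simpa using this
  have h1 : ‖pairingCLM x (fun i => (x i : ℝ))‖ = r ^ 2 := by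
    rw [pairingCLM_apply, pairing, hsq, Real.norm_of_nonneg (by positivity)]
  have h2 := (pairingCLM x).le_opNorm_of_le hx
  rw [h1, sq] at h2
  exact le_of_mul_le_mul_right h2 h0

/-! ### Gluing the local representations. -/

theorem exists_finite_smooth_partition {K : Set (Fin d → ℝ)} (hK : IsCompact K)
    (W : K → Set (Fin d → ℝ)) (hW : ∀ x, IsOpen (W x)) (hxW : ∀ x, (x : Fin d → ℝ) ∈ W x) :
    ∃ (s : Finset K) (χ : s → (Fin d → ℝ) → ℝ), (∀ i, ContDiff ℝ ∞ (χ i)) ∧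
      (∀ i, tsupport (χ i) ⊆ W i) ∧ ∀ θ ∈ K, ∑ i, χ i θ = 1 := by
  obtain ⟨s, hs⟩ := hK.elim_finite_subcover W hW fun x hx => Set.mem_iUnion.2 ⟨⟨x, hx⟩, hxW _⟩
  obtain ⟨f, hf⟩ := SmoothPartitionOfUnity.exists_isSubordinate
    (modelWithCornersSelf ℝ (Fin d → ℝ)) hK.isClosed (fun i : s => W i) (fun i => hW i)
    (by
      intro x hx
      obtain ⟨i, hi, hxi⟩ := Set.mem_iUnion₂.1 (hs hx)
      exact Set.mem_iUnion.2 ⟨⟨i, hi⟩, hxi⟩)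
  refine ⟨s, fun i => f i, fun i => (f i).contMDiff.contDiff, hf, fun θ hθ => ?_⟩
  rw [← finsum_eq_sum_of_fintype]
  exact f.sum_eq_one hθ

theorem character_periodic (z : Fin d → ℤ) : TorusPeriodic (character z) := by
  intro θ m
  have h : pairing (fun i => θ i + 2 * Real.pi * (m i : ℝ)) z
      = pairing θ z + ((∑ i, m i * z i : ℤ) : ℝ) * (2 * Real.pi) := by
    simp only [pairing, add_mul, Finset.sum_add_distrib, Int.cast_sum, Finset.sum_mul, Int.cast_mul]
    congr 1
    exact Finset.sum_congr rfl fun i _ => by ring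
  have h2 : Complex.I * ((pairing θ z + ((∑ i, m i * z i : ℤ) : ℝ) * (2 * Real.pi) : ℝ) : ℂ)
      = Complex.I * (pairing θ z : ℂ) + ((∑ i, m i * z i : ℤ) : ℂ) * (2 * Real.pi * Complex.I) := by
    push_cast
    ring
  rw [character, h, h2, Complex.exp_add, Complex.exp_int_mul_two_pi_mul_I, mul_one, character]

theorem Psihat_periodic (Ψ : TestSpace d n) (θ : Fin d → ℝ) (m : Fin d → ℤ) :
    Psihat Ψ (fun i => θ i + 2 * Real.pi * (m i : ℝ)) = Psihat Ψ θ := by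
  have h : ∀ ψ : (Fin d → ℤ) →₀ (Fin n → ℝ),
      fourierComponent ψ (fun i => θ i + 2 * Real.pi * (m i : ℝ)) = fourierComponent ψ θ := by
    intro ψ
    ext k
    simp only [fourierComponent, character_periodic _ θ m]
  simp only [Psihat, h]

theorem dualGreen_periodic (V : (Fin d → ℤ) → Matrix (Fin n) (Fin n) ℝ) (t : ℝ)
    (θ : Fin d → ℝ) (m : Fin d → ℤ) :
    dualGreen V t (fun i => θ i + 2 * Real.pi * (m i : ℝ)) = dualGreen V t θ := by
  have h : Vhat V (fun i => θ i + 2 * Real.pi * (m i : ℝ)) = Vhat V θ := by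
    simp only [Vhat, character_periodic _ θ m]
  simp only [dualGreen, dualGenerator, h]

theorem exp_neg_pairing (x : Fin d → ℤ) (θ : Fin d → ℝ) :
    Complex.exp (-(Complex.I * (pairing θ x : ℂ))) = character (-x) θ := by
  rw [character]
  congr 1
  simp [pairing]

/-- A component of the integrand of the truncated dual solution. -/
noncomputable def dualIntegrand (V : (Fin d → ℤ) → Matrix (Fin n) (Fin n) ℝ) (g : (Fin d → ℝ) → ℂ)
    (Ψ : TestSpace d n) (x : Fin d → ℤ) (t : ℝ) (c : Fin n ⊕ Fin n) (θ : Fin d → ℝ) : ℂ :=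
  Complex.exp (-(Complex.I * (pairing θ x : ℂ))) * g θ * (dualGreen V t θ *ᵥ Psihat Ψ θ) c

variable {V : (Fin d → ℤ) → Matrix (Fin n) (Fin n) ℝ} {g : (Fin d → ℝ) → ℂ}

theorem dualIntegrand_periodic (hg : TorusPeriodic g) (Ψ : TestSpace d n) (x : Fin d → ℤ) (t : ℝ)
    (c : Fin n ⊕ Fin n) : TorusPeriodic (dualIntegrand V g Ψ x t c) := by
  intro θ m
  simp only [dualIntegrand, exp_neg_pairing, character_periodic _ θ m, hg θ m,
    dualGreen_periodic V t θ m, Psihat_periodic Ψ θ m]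

/-- On the support of `g` continuity is read off from the local representation; elsewhere the
integrand vanishes locally. -/
theorem continuous_dualIntegrand (hV : NonnegativeInteraction V) (hg : Continuous g)
    (hgV : Disjoint (tsupport g) (criticalSet V)) (Ψ : TestSpace d n) (x : Fin d → ℤ) (t : ℝ)
    (c : Fin n ⊕ Fin n) : Continuous (dualIntegrand V g Ψ x t c) := by
  refine continuous_iff_continuousAt.2 fun θ => ?_
  by_cases hθ : θ ∈ tsupport g
  · obtain ⟨W, hW, hθW, -, -, u, su, -, hb⟩ :=
      exists_local_representation hV (Set.disjoint_left.1 hgV hθ)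
    obtain ⟨b, sb, hb⟩ := hb Ψ c
    have h1 : ContinuousAt (fun θ => (dualGreen V t θ *ᵥ Psihat Ψ θ) c) θ := by
      have h2 : ContinuousAt
          (fun θ => ∑ j, Complex.exp (Complex.I * (t * u j θ : ℝ)) * b j θ) θ := by
        refine tendsto_finsetSum _ fun j _ => ContinuousAt.mul ?_
          ((sb j).continuousOn.continuousAt (hW.mem_nhds hθW))
        have := (su j).continuous
        exact Continuous.continuousAt (by fun_prop)
      exact h2.congr (Filter.eventuallyEq_of_mem (hW.mem_nhds hθW) fun y hy => (hb y hy t).symm)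
    have h3 : Continuous fun θ => Complex.exp (-(Complex.I * (pairing θ x : ℂ))) := by
      simp only [exp_neg_pairing]
      exact (contDiff_character _).continuous
    exact (h3.continuousAt.mul hg.continuousAt).mul h1
  · refine (continuousAt_const (y := (0 : ℂ))).congr ?_
    filter_upwards [notMem_tsupport_iff_eventuallyEq.1 hθ] with y hy
    simp [dualIntegrand, hy]

theorem truncatedDual_apply (hV : NonnegativeInteraction V) (hg : Continuous g)
    (hgV : Disjoint (tsupport g) (criticalSet V)) (Ψ : TestSpace d n) (x : Fin d → ℤ) (t : ℝ)
    (c : Fin n ⊕ Fin n) :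
    truncatedDual V g Ψ x t c =
      (((2 * Real.pi) ^ d)⁻¹ : ℝ) • ∫ θ in cell d, dualIntegrand V g Ψ x t c θ := by
  have hcont : Continuous fun θ => (Complex.exp (-(Complex.I * (pairing θ x : ℂ))) * g θ) •
      WithLp.toLp 2 (dualGreen V t θ *ᵥ Psihat Ψ θ) :=
    (PiLp.continuous_toLp 2 (fun _ : Fin n ⊕ Fin n => ℂ)).comp
      (continuous_pi fun c => continuous_dualIntegrand hV hg hgV Ψ x t c)
  have hint : IntegrableOn (fun θ => (Complex.exp (-(Complex.I * (pairing θ x : ℂ))) * g θ) •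
      WithLp.toLp 2 (dualGreen V t θ *ᵥ Psihat Ψ θ)) (cell d) :=
    (hcont.continuousOn.integrableOn_compact
      (isBounded_cell (d := d)).isCompact_closure).mono_set subset_closure
  have := (EuclideanSpace.proj (𝕜 := ℂ) c).integral_comp_comm hint
  rw [truncatedDual, PiLp.smul_apply]
  congr 1
  exact this.symm

/-- The components of the truncated dual solution are finite sums of oscillatory integrals, each
of which obeys both bounds. -/
theorem truncatedDual_component_bounds (hV : NonnegativeInteraction V) (hg : ContDiff ℝ ∞ g)
    (hgp : TorusPeriodic g) (hgV : Disjoint (tsupport g) (criticalSet V)) :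
    ∃ γ > 0, ∀ (Ψ : TestSpace d n) (c : Fin n ⊕ Fin n),
      (∃ C : ℝ, ∀ t : ℝ, t ≠ 0 → ∀ x : Fin d → ℤ,
        ‖truncatedDual V g Ψ x t c‖ ≤ C * |t| ^ (-((d : ℝ) / 2))) ∧
      ∀ N : ℕ, ∃ C : ℝ, 0 ≤ C ∧ ∀ (t : ℝ) (x : Fin d → ℤ), γ * |t| ≤ latticeNorm x →
        ‖truncatedDual V g Ψ x t c‖ ≤ C * ((1 + latticeNorm x) ^ N)⁻¹ := by
  obtain ⟨ρ, sρ, cρ, hρ⟩ := exists_unfolding_weight d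
  -- A periodic `g` lives on all of `ℝ^d`; the compact support of the weight `ρ` reduces the cover
  -- to finitely many neighbourhoods.
  have hK : IsCompact (tsupport ρ ∩ tsupport g) := cρ.isCompact.inter_right (isClosed_tsupport g)
  choose W hW hxW γ hγ u su hdec hrep using fun θ : ↥(tsupport ρ ∩ tsupport g) =>
    exists_local_representation hV (Set.disjoint_left.1 hgV θ.2.2)
  obtain ⟨s, χ, sχ, tχ, hχ⟩ := exists_finite_smooth_partition hK W hW hxW
  refine ⟨1 + ∑ i : s, γ i, add_pos_of_pos_of_nonneg one_pos
    (Finset.sum_nonneg fun i _ => (hγ i).le), fun Ψ c => ?_⟩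
  choose b sb hb using fun i : s => hrep i Ψ c
  set a : s → Fin n ⊕ Fin n → (Fin d → ℝ) → ℂ := fun i j θ => (χ i θ : ℂ) * (ρ θ * g θ) * b i j θ
    with ha
  have tχc : ∀ i, tsupport (fun θ => (χ i θ : ℂ) * (ρ θ * g θ)) ⊆ W i := fun i =>
    (tsupport_mul_subset_left.trans (closure_mono fun θ hθ => by
      rw [Function.mem_support] at hθ ⊢
      exact fun h => hθ (by simp [h]))).trans (tχ i)
  have sa : ∀ i j, ContDiff ℝ ∞ (a i j) := fun i j =>
    OscillatoryIntegral.contDiff_mul_of_tsupport_subset (hW i)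
      ((OscillatoryIntegral.contDiff_ofReal_comp (sχ i)).mul (sρ.mul hg)) (sb i j) (tχc i)
  have ca : ∀ i j, HasCompactSupport (a i j) := fun i j => (cρ.mul_right.mul_left).mul_right
  have ta : ∀ i j, tsupport (a i j) ⊆ W i := fun i j => tsupport_mul_subset_left.trans (tχc i)
  have hformula : ∀ x t, truncatedDual V g Ψ x t c = (((2 * Real.pi) ^ d)⁻¹ : ℝ) • ∑ i : s, ∑ j,
      ∫ θ, Complex.exp (Complex.I * (t * u i j θ - pairingCLM x θ : ℝ)) * a i j θ := by
    intro x t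
    rw [truncatedDual_apply hV hg.continuous hgV, hρ _ (continuous_dualIntegrand hV hg.continuous
      hgV Ψ x t c) (dualIntegrand_periodic hgp Ψ x t c)]
    have hint : ∀ (i : s) j, Integrable fun θ =>
        Complex.exp (Complex.I * (t * u i j θ - pairingCLM x θ : ℝ)) * a i j θ := by
      intro i j
      have h1 := (su i j).continuous
      have h2 := (sa i j).continuous
      have h3 := (pairingCLM x).continuous
      exact Continuous.integrable_of_hasCompactSupport (by fun_prop) (ca i j).mul_left
    congr 1
    simp only [← integral_finsetSum _ fun j _ => hint _ j]
    rw [← integral_finsetSum _ fun i _ => integrable_finsetSum _ fun j _ => hint i j]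
    congr 1
    ext θ
    -- The representation is valid only on `W i`; off it both sides vanish with `χ i`.
    have hterm : ∀ i : s, ∑ j, Complex.exp (Complex.I * (t * u i j θ - pairingCLM x θ : ℝ)) * a i j θ
        = (χ i θ : ℂ) * (ρ θ * dualIntegrand V g Ψ x t c θ) := by
      intro i
      by_cases hi : θ ∈ W i
      · rw [dualIntegrand, hb i θ hi t, Finset.mul_sum, Finset.mul_sum, Finset.mul_sum]
        refine Finset.sum_congr rfl fun j _ => ?_
        have : Complex.exp (Complex.I * (t * u i j θ - pairingCLM x θ : ℝ)) =
            Complex.exp (-(Complex.I * (pairing θ x : ℂ))) *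
              Complex.exp (Complex.I * (t * u i j θ : ℝ)) := by
          rw [← Complex.exp_add, pairingCLM_apply]
          congr 1
          push_cast
          ring
        rw [this]
        simp only [ha]
        ring
      · have h0 : χ i θ = 0 := image_eq_zero_of_notMem_tsupport fun h => hi (tχ i h)
        simp [ha, h0]
    rw [Finset.sum_congr rfl fun i _ => hterm i, ← Finset.sum_mul]
    by_cases hθ : θ ∈ tsupport ρ ∩ tsupport g
    · have : ∑ i, (χ i θ : ℂ) = 1 := by exact_mod_cast hχ θ hθ
      rw [this, one_mul]
    · have : ρ θ * dualIntegrand V g Ψ x t c θ = 0 := by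
        rw [Set.mem_inter_iff, not_and_or] at hθ
        rcases hθ with h | h <;>
          simp [dualIntegrand, image_eq_zero_of_notMem_tsupport h]
      simp [this]
  set κ : ℝ := ‖(((2 * Real.pi) ^ d)⁻¹ : ℝ)‖
  have hκ : 0 ≤ κ := norm_nonneg _
  have hsum : ∀ x t (q : s → Fin n ⊕ Fin n → ℝ), (∀ (i : s) j,
      ‖∫ θ, Complex.exp (Complex.I * (t * u i j θ - pairingCLM x θ : ℝ)) * a i j θ‖ ≤ q i j) →
      ‖truncatedDual V g Ψ x t c‖ ≤ κ * ∑ i, ∑ j, q i j := by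
    intro x t q hq
    rw [hformula, norm_smul]
    exact mul_le_mul_of_nonneg_left (norm_sum_le_of_le _ fun i _ => norm_sum_le_of_le _ fun j _ =>
      hq i j) hκ
  constructor
  · choose C hC using fun (i : s) j => (hdec i j (a i j) (sa i j) (ca i j) (ta i j)).1
    refine ⟨κ * ∑ i, ∑ j, C i j, fun t ht x => ?_⟩
    refine (hsum x t _ fun i j => hC i j t ht (pairingCLM x)).trans_eq ?_
    simp only [← Finset.sum_mul, mul_assoc]
  · intro N
    choose C hC using fun (i : s) j => (hdec i j (a i j) (sa i j) (ca i j) (ta i j)).2 N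
    refine ⟨κ * ∑ i, ∑ j, |C i j|, mul_nonneg hκ (Finset.sum_nonneg fun i _ =>
      Finset.sum_nonneg fun j _ => abs_nonneg _), fun t x hx => ?_⟩
    have h0 : 0 ≤ latticeNorm x := norm_nonneg _
    have hL := latticeNorm_le_norm_pairingCLM x
    refine (hsum x t (fun i j => |C i j| * ((1 + latticeNorm x) ^ N)⁻¹) fun i j => ?_).trans_eq ?_
    · refine (hC i j t (pairingCLM x) (le_trans ?_ (hx.trans hL))).trans ?_
      · refine mul_le_mul_of_nonneg_right ?_ (abs_nonneg t)
        have := Finset.single_le_sum (f := fun i : s => γ i) (fun i _ => (hγ i).le)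
          (Finset.mem_univ i)
        linarith
      · refine mul_le_mul (le_abs_self _) ?_ (by positivity) (abs_nonneg _)
        gcongr
    · simp only [← Finset.sum_mul, mul_assoc]

/-! ### From components to the full solution. -/

theorem norm_le_sum_norm_apply {ι : Type*} [Fintype ι] (v : EuclideanSpace ℂ ι) :
    ‖v‖ ≤ ∑ i, ‖v i‖ := by
  classical
  conv_lhs => rw [← (EuclideanSpace.basisFun ι ℂ).sum_repr v]
  refine norm_sum_le_of_le _ fun i _ => ?_
  rw [norm_smul, (EuclideanSpace.basisFun ι ℂ).norm_eq_one, mul_one]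
  simp

end HarmonicCrystal

theorem lemma5p1 {d n : ℕ} (hd : 1 ≤ d) (hn : 1 ≤ n)
    (V : (Fin d → ℤ) → Matrix (Fin n) (Fin n) ℝ)
    (hE1 : HarmonicCrystal.ExponentialDecay V)
    (hE2 : HarmonicCrystal.SymmetricInteraction V)
    (hE3 : HarmonicCrystal.NonnegativeInteraction V)
    (g : (Fin d → ℝ) → ℂ) (hg_smooth : ContDiff ℝ ∞ g)
    (hg_periodic : HarmonicCrystal.TorusPeriodic g)
    (hg_support : Disjoint (tsupport g) (HarmonicCrystal.criticalSet V)) :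
    (∀ Ψ : HarmonicCrystal.TestSpace d n, ∃ C > 0, ∀ t : ℝ, t ≠ 0 → ∀ x : Fin d → ℤ,
      ‖HarmonicCrystal.truncatedDual V g Ψ x t‖ ≤ C * |t| ^ (-((d : ℝ) / 2))) ∧
    (∃ γ > 0, ∀ (Ψ : HarmonicCrystal.TestSpace d n) (p : ℝ), 0 < p → ∃ Cp > 0,
      ∀ (t : ℝ) (x : Fin d → ℤ), γ * |t| ≤ HarmonicCrystal.latticeNorm x →
        ‖HarmonicCrystal.truncatedDual V g Ψ x t‖ ≤
          Cp * (|t| + HarmonicCrystal.latticeNorm x + 1) ^ (-p)) := by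
  obtain ⟨γ, hγ, h⟩ := HarmonicCrystal.truncatedDual_component_bounds hE3 hg_smooth hg_periodic
    hg_support
  constructor
  · intro Ψ
    choose C hC using fun c => (h Ψ c).1
    refine ⟨1 + ∑ c, |C c|, by positivity, fun t ht x => ?_⟩
    refine (HarmonicCrystal.norm_le_sum_norm_apply _).trans
      ((Finset.sum_le_sum fun c _ => hC c t ht x).trans ?_)
    rw [← Finset.sum_mul]
    refine mul_le_mul_of_nonneg_right ?_ (by positivity)
    have := Finset.sum_le_sum fun c (_ : c ∈ Finset.univ) => le_abs_self (C c)
    linarith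
  -- The extra `1` yields `|t| ≤ |x|` in this region, so `|t| + |x| + 1 ≤ 2 (1 + |x|)`. This
  -- explains the factor `2 ^ N` below, with `N ≥ p` an integer.
  · refine ⟨γ + 1, by positivity, fun Ψ p hp => ?_⟩
    obtain ⟨N, hN⟩ := exists_nat_ge p
    choose C hC0 hC using fun c => (h Ψ c).2 N
    have hS : 0 ≤ ∑ c, C c := Finset.sum_nonneg fun c _ => hC0 c
    refine ⟨(1 + ∑ c, C c) * 2 ^ N, by positivity, fun t x hx => ?_⟩
    set r := HarmonicCrystal.latticeNorm x with hr
    have hr0 : 0 ≤ r := norm_nonneg _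
    have ht := abs_nonneg t
    have h1 : γ * |t| ≤ r := by nlinarith
    have h2 : |t| ≤ r := by nlinarith
    refine (HarmonicCrystal.norm_le_sum_norm_apply _).trans
      ((Finset.sum_le_sum fun c _ => hC c t x h1).trans ?_)
    rw [← Finset.sum_mul, mul_assoc]
    refine mul_le_mul (by linarith) ?_ (by positivity) (by positivity)
    have h3 : (|t| + r + 1) ^ p ≤ (2 * (1 + r)) ^ N := by
      calc (|t| + r + 1) ^ p ≤ (|t| + r + 1) ^ (N : ℝ) :=
            Real.rpow_le_rpow_of_exponent_le (by linarith) hN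
        _ = (|t| + r + 1) ^ N := Real.rpow_natCast _ _
        _ ≤ (2 * (1 + r)) ^ N := by
            gcongr
            linarith
    rw [Real.rpow_neg (by positivity), ← div_eq_mul_inv, le_div_iff₀ (by positivity), ← hr,
      inv_mul_le_iff₀ (by positivity), ← mul_pow, mul_comm (1 + r)]
    exact h3
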